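/- Let $M$ be a smooth manifold of dimension $m$, let $\tau: LM\to M$ be its bundle of linear frames $u:\mathbb R^m\to T_xM$ (a principal bundle with group $GL(m)$, acting by $u\cdot A=u\circ A$), and let $J^1\tau$ be the bundle of $1$-jets of local sections of $\tau$, with projection $\tau_{10}:J^1\tau\to LM$. A jet $\rho\in J^1\tau$ over $u\in LM$ is regarded as a linear map $\rho:T_{\tau(u)}M\to T_uLM$ with $T_u\tau\circ\rho=\mathrm{id}$. A chart $(x^\mu)$ of $M$ induces fibered charts $(x^\mu,e^\mu_k)$ of $LM$, with $u(\mathbf e_k)=e^\mu_k\,\partial/\partial x^\mu$, and $(x^\mu,e^\mu_k,e^\mu_{k\sigma})$ of $J^1\tau$, with $e^\mu_{k\sigma}(\rho)=\mathbf d e^\mu_k(\rho(\partial/\partial x^\sigma))$; let $(e^k_\mu)$ denote the inverse matrix of $(e^\mu_k)$. Let $\theta\in\Omega^1(J^1\tau,\mathbb R^m)$ be the canonical form, $\theta_\rho(Y)=u^{-1}\big(T_u\tau(T_\rho\tau_{10}(Y))\big)$ for $\rho$ over $u$. Let $\omega\in\Omega^1(J^1\tau,\mathfrak{gl}(m))$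 be the universal connection form: $\omega_\rho(Y)$ is the element of $\mathfrak{gl}(m)$ whose infinitesimal generator at $u$ is the vertical vector $(\mathrm{id}-\rho\circ T_u\tau)(T_\rho\tau_{10}(Y))$. Let $T=\mathbf d\theta+\omega\wedge\theta$, that is, $T(X,Y)=\mathbf d\theta(X,Y)+\omega(X)\theta(Y)-\omega(Y)\theta(X)$, be the universal torsion form. Then there is an embedded smooth submanifold $\iota_0:T_0\hookrightarrow J^1\tau$ such that $\iota_0^*T=0$ and such that, over the domain of every chart of $M$, $T_0$ is exactly the set of the jets that satisfy $$e^\mu_{i\nu}e^i_\sigma-e^\mu_{i\sigma}e^i_\nu=0\qquad\text{for all }\mu,\nu,\sigma$$ (summation over $i$) in the induced coordinates. These conditions are independent of the choice of coordinates: for any two charts of $M$ and any jet over the intersection of their domains, the conditions hold in the coordinates induced by the first chart if and only if they hold in those induced by the second. -/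

import Mathlib

open scoped Manifold ContDiff
open Set

noncomputable section

namespace FrameJet

section Core
variable {F N : Type*} [NormedAddCommGroup F] [NormedSpace ℝ F]

/-- A manifold from a family of bijective charts onto open subsets of a normed space, with smooth
changes of coordinates. -/
structure SmoothAtlas (F N : Type*) [NormedAddCommGroup F] [NormedSpace ℝ F] where
  charts : Set (PartialEquiv N F)
  chartAt : N → PartialEquiv N F
  mem_source : ∀ x, x ∈ (chartAt x).source
  chartAt_mem : ∀ x, chartAt x ∈ charts
  isOpen : ∀ e ∈ charts, ∀ e' ∈ charts, IsOpen (e.symm.trans e').source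
  contDiffOn : ∀ e ∈ charts, ∀ e' ∈ charts,
    ContDiffOn ℝ ∞ (e.symm.trans e') (e.symm.trans e').source

/-- The underlying core of charts of Mathlib. -/
def SmoothAtlas.core (c : SmoothAtlas F N) : ChartedSpaceCore F N where
  atlas := c.charts
  chartAt := c.chartAt
  mem_chart_source := c.mem_source
  chart_mem_atlas := c.chartAt_mem
  open_source e e' he he' := c.isOpen e he e' he'
  continuousOn_toFun e e' he he' := (c.contDiffOn e he e' he').continuousOn

theorem SmoothAtlas.isManifold (c : SmoothAtlas F N) :
    @IsManifold ℝ _ F _ _ F _ 𝓘(ℝ, F) ∞ N c.core.toTopologicalSpace c.core.toChartedSpace := by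
  let _ := c.core.toTopologicalSpace
  let _ := c.core.toChartedSpace
  apply isManifold_of_contDiffOn
  intro e e' he he'
  change e ∈ ⋃ (e : PartialEquiv N F) (he : e ∈ c.core.atlas),
    {c.core.openPartialHomeomorph e he} at he
  change e' ∈ ⋃ (e : PartialEquiv N F) (he : e ∈ c.core.atlas),
    {c.core.openPartialHomeomorph e he} at he'
  simp only [mem_iUnion, mem_singleton_iff] at he he'
  obtain ⟨e, he, rfl⟩ := he
  obtain ⟨e', he', rfl⟩ := he'
  have := c.contDiffOn e he e' he'
  simpa using! this

end Core

section Charts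

variable {F N : Type*} [NormedAddCommGroup F] [NormedSpace ℝ F] [TopologicalSpace N]
  [ChartedSpace F N] {φ ψ : OpenPartialHomeomorph N F}

theorem chart_mdifferentiable (hφ : φ ∈ IsManifold.maximalAtlas 𝓘(ℝ, F) ∞ N) :
    φ.MDifferentiable 𝓘(ℝ, F) 𝓘(ℝ, F) :=
  ⟨(contMDiffOn_of_mem_maximalAtlas hφ).mdifferentiableOn (by simp),
    (contMDiffOn_symm_of_mem_maximalAtlas hφ).mdifferentiableOn (by simp)⟩

theorem chart_transition (hφ : φ ∈ IsManifold.maximalAtlas 𝓘(ℝ, F) ∞ N)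
    (hψ : ψ ∈ IsManifold.maximalAtlas 𝓘(ℝ, F) ∞ N) :
    ContDiffOn ℝ ∞ (ψ ∘ φ.symm) (φ.symm ≫ₕ ψ).source := by
  have h : ContMDiffOn 𝓘(ℝ, F) 𝓘(ℝ, F) ∞ (ψ ∘ φ.symm) (φ.symm ≫ₕ ψ).source := by
    refine (contMDiffOn_of_mem_maximalAtlas hψ).comp
      ((contMDiffOn_symm_of_mem_maximalAtlas hφ).mono ?_) ?_
    · intro y hy; simp at hy; exact hy.1
    · intro y hy; simp at hy; exact hy.2
  exact h.contDiffOn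

theorem chart_fderiv_transition [IsManifold 𝓘(ℝ, F) ∞ N] (hφ : φ ∈ IsManifold.maximalAtlas 𝓘(ℝ, F) ∞ N)
    (hψ : ψ ∈ IsManifold.maximalAtlas 𝓘(ℝ, F) ∞ N) {y : F} (hy : y ∈ (φ.symm ≫ₕ ψ).source) :
    ((mfderiv 𝓘(ℝ, F) 𝓘(ℝ, F) ψ (φ.symm y)).comp (mfderiv 𝓘(ℝ, F) 𝓘(ℝ, F) φ.symm y) : F →L[ℝ] F)
      = fderiv ℝ (ψ ∘ φ.symm) y := by
  have hy' : y ∈ φ.target ∧ φ.symm y ∈ ψ.source := by simpa using hy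
  rw [← mfderiv_eq_fderiv]
  exact (mfderiv_comp y ((chart_mdifferentiable hψ).mdifferentiableAt hy'.2)
    ((chart_mdifferentiable hφ).mdifferentiableAt_symm hy'.1)).symm

end Charts

/-- The Euclidean space `ℝ^m`. -/
abbrev V (m : ℕ) := EuclideanSpace ℝ (Fin m)

/-- The bundle of frames `LM` of an `m`-dimensional manifold: points `x` of `M` with a linear
isomorphism `ℝ^m → T_x M`. -/
structure FrameBundle (m : ℕ) (M : Type*) [TopologicalSpace M] [ChartedSpace (V m) M] where
  base : M
  frame : V m ≃L[ℝ] TangentSpace (𝓡 m) base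

abbrev FrameModel (m : ℕ) := V m × (V m →L[ℝ] V m)

namespace FrameBundle
variable {m : ℕ} {M : Type*} [TopologicalSpace M] [ChartedSpace (V m) M]

theorem ext' {u v : FrameBundle m M} (h : u.base = v.base)
    (h' : ∀ w : V m, (u.frame w : V m) = (v.frame w : V m)) : u = v := by
  obtain ⟨x, e⟩ := u
  obtain ⟨y, e'⟩ := v
  obtain rfl : x = y := h
  congr 1
  ext1
  funext w
  exact h' w

/-- The coordinates `(x^μ, e^ν_k)` of a frame in a chart of `M`: the base point in the chart, and
the linear map whose matrix is `(e^ν_k)`. -/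
def coord (φ : OpenPartialHomeomorph M (V m)) (u : FrameBundle m M) : FrameModel m :=
  (φ u.base, (mfderiv (𝓡 m) (𝓡 m) φ u.base).comp u.frame.toContinuousLinearMap)

open Classical in
/-- The inverse of the coordinate map `coord φ`. -/
def ofCoord (φ : OpenPartialHomeomorph M (V m)) (p : FrameModel m) : FrameBundle m M where
  base := φ.symm p.1
  frame :=
    let B : V m →L[ℝ] V m := (mfderiv (𝓡 m) (𝓡 m) φ.symm p.1 : V m →L[ℝ] V m) ∘L p.2
    if h : B.IsInvertible then (h.choose : V m ≃L[ℝ] V m) else ContinuousLinearEquiv.refl ℝ (V m)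

variable {φ ψ : OpenPartialHomeomorph M (V m)}

theorem D_isInvertible (hφ : φ ∈ IsManifold.maximalAtlas (𝓡 m) ∞ M) {x : M} (hx : x ∈ φ.source) :
    (mfderiv (𝓡 m) (𝓡 m) φ x : V m →L[ℝ] V m).IsInvertible :=
  ⟨(chart_mdifferentiable hφ).mfderiv hx, rfl⟩

theorem D_symm_isInvertible (hφ : φ ∈ IsManifold.maximalAtlas (𝓡 m) ∞ M) {y : V m}
    (hy : y ∈ φ.target) :
    (mfderiv (𝓡 m) (𝓡 m) φ.symm y : V m →L[ℝ] V m).IsInvertible :=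
  ⟨(chart_mdifferentiable hφ).symm.mfderiv hy, rfl⟩

theorem D_symm_D (hφ : φ ∈ IsManifold.maximalAtlas (𝓡 m) ∞ M) {x : M} (hx : x ∈ φ.source)
    (w : V m) :
    (mfderiv (𝓡 m) (𝓡 m) φ.symm (φ x) : V m →L[ℝ] V m)
      ((mfderiv (𝓡 m) (𝓡 m) φ x : V m →L[ℝ] V m) w) = w :=
  DFunLike.congr_fun ((chart_mdifferentiable hφ).symm_comp_deriv hx) w

theorem D_D_symm (hφ : φ ∈ IsManifold.maximalAtlas (𝓡 m) ∞ M) {y : V m} (hy : y ∈ φ.target)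
    (w : V m) :
    (mfderiv (𝓡 m) (𝓡 m) φ (φ.symm y) : V m →L[ℝ] V m)
      ((mfderiv (𝓡 m) (𝓡 m) φ.symm y : V m →L[ℝ] V m) w) = w :=
  DFunLike.congr_fun ((chart_mdifferentiable hφ).comp_symm_deriv hy) w

theorem ofCoord_frame (hφ : φ ∈ IsManifold.maximalAtlas (𝓡 m) ∞ M) {p : FrameModel m}
    (hp : p.1 ∈ φ.target) (hp' : p.2.IsInvertible) (w : V m) :
    ((ofCoord φ p).frame w : V m) = (mfderiv (𝓡 m) (𝓡 m) φ.symm p.1 : V m →L[ℝ] V m) (p.2 w) := by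
  have h : ((mfderiv (𝓡 m) (𝓡 m) φ.symm p.1 : V m →L[ℝ] V m) ∘L p.2).IsInvertible :=
    (D_symm_isInvertible hφ hp).comp hp'
  have : (ofCoord φ p).frame = (h.choose : V m ≃L[ℝ] V m) := dif_pos h
  rw [this]
  exact DFunLike.congr_fun h.choose_spec w

/-- The fibered chart `(x^μ, e^ν_k)` of `LM` induced by a chart of `M`. -/
def chart (φ : OpenPartialHomeomorph M (V m)) (hφ : φ ∈ IsManifold.maximalAtlas (𝓡 m) ∞ M) :
    PartialEquiv (FrameBundle m M) (FrameModel m) where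
  toFun := coord φ
  invFun := ofCoord φ
  source := {u | u.base ∈ φ.source}
  target := {p | p.1 ∈ φ.target ∧ p.2.IsInvertible}
  map_source' u hu :=
    ⟨φ.map_source hu, (D_isInvertible hφ hu).comp ContinuousLinearMap.isInvertible_equiv⟩
  map_target' p hp := φ.map_target hp.1
  left_inv' u hu := by
    refine ext' (φ.left_inv hu) fun w => ?_
    rw [ofCoord_frame hφ (φ.map_source hu)
      ((D_isInvertible hφ hu).comp ContinuousLinearMap.isInvertible_equiv)]
    exact D_symm_D hφ hu _
  right_inv' p hp := by
    refine Prod.ext (φ.right_inv hp.1) ?_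
    ext1 w
    change (mfderiv (𝓡 m) (𝓡 m) φ (φ.symm p.1) : V m →L[ℝ] V m) ((ofCoord φ p).frame w : V m) = _
    rw [ofCoord_frame hφ hp.1 hp.2]
    exact D_D_symm hφ hp.1 _

theorem isOpen_isInvertible : IsOpen {A : V m →L[ℝ] V m | A.IsInvertible} :=
  ContinuousLinearEquiv.isOpen

theorem chart_trans_source (hφ : φ ∈ IsManifold.maximalAtlas (𝓡 m) ∞ M)
    (hψ : ψ ∈ IsManifold.maximalAtlas (𝓡 m) ∞ M) :
    ((chart φ hφ).symm.trans (chart ψ hψ)).source =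
      (φ.symm ≫ₕ ψ).source ×ˢ {A : V m →L[ℝ] V m | A.IsInvertible} := by
  ext p
  simp only [PartialEquiv.trans_source, PartialEquiv.symm_source, mem_inter_iff, mem_preimage,
    mem_prod, mem_ofPred_eq, OpenPartialHomeomorph.trans_source]
  constructor
  · rintro ⟨⟨h1, h2⟩, h3⟩
    exact ⟨⟨h1, h3⟩, h2⟩
  · rintro ⟨⟨h1, h3⟩, h2⟩
    exact ⟨⟨h1, h2⟩, h3⟩

theorem isOpen_chart_trans_source (hφ : φ ∈ IsManifold.maximalAtlas (𝓡 m) ∞ M)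
    (hψ : ψ ∈ IsManifold.maximalAtlas (𝓡 m) ∞ M) :
    IsOpen ((chart φ hφ).symm.trans (chart ψ hψ)).source := by
  rw [chart_trans_source]
  exact (φ.symm ≫ₕ ψ).open_source.prod isOpen_isInvertible

variable [IsManifold (𝓡 m) ∞ M]

theorem chart_trans_apply (hφ : φ ∈ IsManifold.maximalAtlas (𝓡 m) ∞ M)
    (hψ : ψ ∈ IsManifold.maximalAtlas (𝓡 m) ∞ M) {p : FrameModel m}
    (hp : p ∈ (φ.symm ≫ₕ ψ).source ×ˢ {A : V m →L[ℝ] V m | A.IsInvertible}) :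
    coord ψ (ofCoord φ p) = ((ψ ∘ φ.symm) p.1, fderiv ℝ (ψ ∘ φ.symm) p.1 ∘L p.2) := by
  refine Prod.ext rfl ?_
  ext1 w
  change (mfderiv (𝓡 m) (𝓡 m) ψ (φ.symm p.1) : V m →L[ℝ] V m) ((ofCoord φ p).frame w : V m) = _
  rw [ofCoord_frame hφ (by have := hp.1; simp at this; exact this.1) hp.2,
    ← chart_fderiv_transition hφ hψ hp.1]
  rfl

theorem contDiffOn_chart_trans (hφ : φ ∈ IsManifold.maximalAtlas (𝓡 m) ∞ M)
    (hψ : ψ ∈ IsManifold.maximalAtlas (𝓡 m) ∞ M) :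
    ContDiffOn ℝ ∞ ((chart φ hφ).symm.trans (chart ψ hψ))
      ((chart φ hφ).symm.trans (chart ψ hψ)).source := by
  rw [chart_trans_source]
  have h := chart_transition hφ hψ
  have hmaps : MapsTo (Prod.fst : FrameModel m → V m)
      ((φ.symm ≫ₕ ψ).source ×ˢ {A : V m →L[ℝ] V m | A.IsInvertible}) (φ.symm ≫ₕ ψ).source :=
    fun p hp => hp.1
  have h1 : ContDiffOn ℝ ∞ (fun p : FrameModel m =>
      (((ψ ∘ φ.symm) p.1, fderiv ℝ (ψ ∘ φ.symm) p.1 ∘L p.2) : FrameModel m))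
      ((φ.symm ≫ₕ ψ).source ×ˢ {A : V m →L[ℝ] V m | A.IsInvertible}) := by
    refine (h.comp contDiffOn_fst hmaps).prodMk ?_
    exact ((h.fderiv_of_isOpen (φ.symm ≫ₕ ψ).open_source (by simp)).comp contDiffOn_fst
      hmaps).clm_comp contDiffOn_snd
  exact h1.congr fun p hp => chart_trans_apply hφ hψ hp

variable (m M) in
/-- The smooth structure of `LM`, given by the fibered charts induced by all charts of `M`. -/
def smoothAtlas : SmoothAtlas (FrameModel m) (FrameBundle m M) where
  charts := {e | ∃ φ hφ, e = chart φ hφ}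
  chartAt u := chart (chartAt (V m) u.base) (IsManifold.chart_mem_maximalAtlas u.base)
  mem_source u := mem_chart_source (V m) u.base
  chartAt_mem u := ⟨_, _, rfl⟩
  isOpen := by
    rintro _ ⟨φ, hφ, rfl⟩ _ ⟨ψ, hψ, rfl⟩
    exact isOpen_chart_trans_source hφ hψ
  contDiffOn := by
    rintro _ ⟨φ, hφ, rfl⟩ _ ⟨ψ, hψ, rfl⟩
    exact contDiffOn_chart_trans hφ hψ

instance : TopologicalSpace (FrameBundle m M) := (smoothAtlas m M).core.toTopologicalSpace

instance : ChartedSpace (FrameModel m) (FrameBundle m M) := (smoothAtlas m M).core.toChartedSpace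

instance : IsManifold 𝓘(ℝ, FrameModel m) ∞ (FrameBundle m M) := (smoothAtlas m M).isManifold

/-- The fibered charts are charts of the manifold `LM`. -/
def openChart (φ : OpenPartialHomeomorph M (V m)) (hφ : φ ∈ IsManifold.maximalAtlas (𝓡 m) ∞ M) :
    OpenPartialHomeomorph (FrameBundle m M) (FrameModel m) :=
  (smoothAtlas m M).core.openPartialHomeomorph (chart φ hφ) ⟨φ, hφ, rfl⟩

theorem openChart_mem (hφ : φ ∈ IsManifold.maximalAtlas (𝓡 m) ∞ M) :
    openChart φ hφ ∈ IsManifold.maximalAtlas 𝓘(ℝ, FrameModel m) ∞ (FrameBundle m M) := by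
  apply IsManifold.subset_maximalAtlas
  change _ ∈ ⋃ (e : PartialEquiv (FrameBundle m M) (FrameModel m))
    (he : e ∈ (smoothAtlas m M).core.atlas), {(smoothAtlas m M).core.openPartialHomeomorph e he}
  simp only [mem_iUnion, mem_singleton_iff]
  exact ⟨chart φ hφ, ⟨φ, hφ, rfl⟩, rfl⟩

theorem contMDiff_base : ContMDiff 𝓘(ℝ, FrameModel m) (𝓡 m) ∞ (base : FrameBundle m M → M) := by
  intro u
  have hφ : chartAt (V m) u.base ∈ IsManifold.maximalAtlas (𝓡 m) ∞ M :=
    IsManifold.chart_mem_maximalAtlas u.base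
  have hu : u ∈ (openChart _ hφ).source := mem_chart_source (V m) u.base
  have h1 := contMDiffOn_of_mem_maximalAtlas (openChart_mem hφ)
  have h2 := contMDiffOn_symm_of_mem_maximalAtlas hφ
  have h3 : ContMDiffOn 𝓘(ℝ, FrameModel m) (𝓡 m) ∞
      ((chartAt (V m) u.base).symm ∘ Prod.fst ∘ openChart _ hφ) (openChart _ hφ).source :=
    h2.comp (contDiff_fst.contMDiff.comp_contMDiffOn h1)
      fun v hv => ((openChart _ hφ).map_source hv).1
  refine (h3.congr fun v hv => ?_).contMDiffAt ((openChart _ hφ).open_source.mem_nhds hu)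
  exact ((chartAt (V m) u.base).left_inv hv).symm

/-- Differential of a fibered chart of `LM`. -/
def D (φ : OpenPartialHomeomorph M (V m)) (u : FrameBundle m M) : FrameModel m →L[ℝ] FrameModel m :=
  mfderiv 𝓘(ℝ, FrameModel m) 𝓘(ℝ, FrameModel m) (coord φ) u

/-- Differential of the inverse of a fibered chart of `LM`. -/
def DInv (φ : OpenPartialHomeomorph M (V m)) (p : FrameModel m) :
    FrameModel m →L[ℝ] FrameModel m :=
  mfderiv 𝓘(ℝ, FrameModel m) 𝓘(ℝ, FrameModel m) (ofCoord (M := M) φ) p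

/-- Differential of the projection `LM → M`. -/
def DBase (u : FrameBundle m M) : FrameModel m →L[ℝ] V m :=
  mfderiv 𝓘(ℝ, FrameModel m) (𝓡 m) (base : FrameBundle m M → M) u

theorem DInv_D (hφ : φ ∈ IsManifold.maximalAtlas (𝓡 m) ∞ M) {u : FrameBundle m M}
    (hu : u.base ∈ φ.source) (Y : FrameModel m) : DInv (M := M) φ (coord φ u) (D φ u Y) = Y :=
  DFunLike.congr_fun ((chart_mdifferentiable (openChart_mem hφ)).symm_comp_deriv hu) Y

theorem D_DInv (hφ : φ ∈ IsManifold.maximalAtlas (𝓡 m) ∞ M) {p : FrameModel m}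
    (hp : p.1 ∈ φ.target ∧ p.2.IsInvertible) (Y : FrameModel m) :
    D φ (ofCoord (M := M) φ p) (DInv (M := M) φ p Y) = Y :=
  DFunLike.congr_fun ((chart_mdifferentiable (openChart_mem hφ)).comp_symm_deriv hp) Y

theorem D_fst (hφ : φ ∈ IsManifold.maximalAtlas (𝓡 m) ∞ M) {u : FrameBundle m M}
    (hu : u.base ∈ φ.source) (Y : FrameModel m) :
    (D φ u Y).1 = (mfderiv (𝓡 m) (𝓡 m) φ u.base : V m →L[ℝ] V m) (DBase u Y) := by
  have h1 : MDifferentiableAt 𝓘(ℝ, FrameModel m) 𝓘(ℝ, FrameModel m) (coord φ) u :=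
    (chart_mdifferentiable (openChart_mem hφ)).mdifferentiableAt hu
  have h2 : MDifferentiableAt 𝓘(ℝ, FrameModel m) (𝓡 m) (base : FrameBundle m M → M) u :=
    (contMDiff_base u).mdifferentiableAt (by simp)
  have h3 : MDifferentiableAt (𝓡 m) (𝓡 m) φ u.base :=
    (chart_mdifferentiable hφ).mdifferentiableAt hu
  have e1 := mfderiv_comp u (g := (Prod.fst : FrameModel m → V m)) (I' := 𝓘(ℝ, FrameModel m))
    (I'' := 𝓡 m) differentiableAt_fst.mdifferentiableAt h1
  have e2 := mfderiv_comp u (g := φ) h3 h2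
  have e3 : (Prod.fst : FrameModel m → V m) ∘ coord φ = φ ∘ (base : FrameBundle m M → M) := rfl
  rw [e3, e2, mfderiv_eq_fderiv, fderiv_fst] at e1
  exact (DFunLike.congr_fun e1 Y).symm

/-- In coordinates, a horizontal lift at a frame is `∂_σ ↦ ∂_σ + e^ν_{kσ} ∂/∂e^ν_k`. -/
def liftOf (φ : OpenPartialHomeomorph M (V m)) (p : FrameModel m)
    (P : V m →L[ℝ] V m →L[ℝ] V m) : V m →L[ℝ] FrameModel m :=
  DInv (M := M) φ p ∘L ((ContinuousLinearMap.id ℝ (V m)).prod P) ∘L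
    (mfderiv (𝓡 m) (𝓡 m) φ (φ.symm p.1) : V m →L[ℝ] V m)

theorem DBase_liftOf (hφ : φ ∈ IsManifold.maximalAtlas (𝓡 m) ∞ M) {p : FrameModel m}
    (hp : p.1 ∈ φ.target ∧ p.2.IsInvertible) (P : V m →L[ℝ] V m →L[ℝ] V m) :
    DBase (ofCoord (M := M) φ p) ∘L liftOf (M := M) φ p P = ContinuousLinearMap.id ℝ (V m) := by
  ext1 w
  have hx : (ofCoord (M := M) φ p).base ∈ φ.source := φ.map_target hp.1
  have h := D_fst hφ hx (liftOf (M := M) φ p P w)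
  have h2 : D φ (ofCoord (M := M) φ p) (liftOf (M := M) φ p P w) = _ := D_DInv hφ hp _
  rw [h2] at h
  exact ((chart_mdifferentiable hφ).mfderiv_injective hx h).symm

end FrameBundle

/-- The bundle `J¹τ` of 1-jets of local sections of `τ : LM → M`: the 1-jet at `x` of a local
section `s` is the point `u = s(x)` together with the linear map `T_x s : T_x M → T_u LM`, that is,
a linear right inverse of `T_u τ`. -/
structure JetBundle (m : ℕ) (M : Type*) [TopologicalSpace M] [ChartedSpace (V m) M]
    [IsManifold (𝓡 m) ∞ M] where
  pt : FrameBundle m M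
  lift : TangentSpace (𝓡 m) pt.base →L[ℝ] TangentSpace 𝓘(ℝ, FrameModel m) pt
  proj : (mfderiv 𝓘(ℝ, FrameModel m) (𝓡 m) FrameBundle.base pt).comp lift =
    ContinuousLinearMap.id ℝ (TangentSpace (𝓡 m) pt.base)

abbrev JetModel (m : ℕ) := V m × (V m →L[ℝ] V m) × (V m →L[ℝ] V m →L[ℝ] V m)

namespace JetBundle
variable {m : ℕ} {M : Type*} [TopologicalSpace M] [ChartedSpace (V m) M] [IsManifold (𝓡 m) ∞ M]

theorem ext' {ρ ρ' : JetBundle m M} (h : ρ.pt = ρ'.pt)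
    (h' : ∀ w : V m, (ρ.lift w : FrameModel m) = (ρ'.lift w : FrameModel m)) : ρ = ρ' := by
  obtain ⟨u, l, hl⟩ := ρ
  obtain ⟨u', l', hl'⟩ := ρ'
  obtain rfl : u = u' := h
  congr 1
  ext1 w
  exact h' w

/-- The coordinates `(x^μ, e^ν_k, e^ν_{kσ})` of a jet in a chart of `M`. The last one is the linear
map sending the `σ`-th basis vector to the matrix `(e^ν_{kσ})` of the derivatives of the functions
`e^ν_k` along the lift of `∂/∂x^σ`. -/
def coord (φ : OpenPartialHomeomorph M (V m)) (ρ : JetBundle m M) : JetModel m :=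
  (φ ρ.pt.base, (FrameBundle.coord φ ρ.pt).2,
    ContinuousLinearMap.snd ℝ (V m) (V m →L[ℝ] V m) ∘L
      (mfderiv 𝓘(ℝ, FrameModel m) 𝓘(ℝ, FrameModel m) (FrameBundle.coord φ) ρ.pt).comp
        (ρ.lift.comp (mfderiv (𝓡 m) (𝓡 m) φ.symm (φ ρ.pt.base) : V m →L[ℝ] V m)))

theorem exists_lift (u : FrameBundle m M) : ∃ l : V m →L[ℝ] FrameModel m,
    FrameBundle.DBase u ∘L l = ContinuousLinearMap.id ℝ (V m) := by
  have hφ : chartAt (V m) u.base ∈ IsManifold.maximalAtlas (𝓡 m) ∞ M :=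
    IsManifold.chart_mem_maximalAtlas u.base
  have hu : u ∈ (FrameBundle.chart _ hφ).source := mem_chart_source (V m) u.base
  have := FrameBundle.DBase_liftOf hφ ((FrameBundle.chart _ hφ).map_source hu) 0
  have e : FrameBundle.ofCoord _ (FrameBundle.coord _ u) = u :=
    (FrameBundle.chart _ hφ).left_inv hu
  change FrameBundle.DBase (FrameBundle.ofCoord _ (FrameBundle.coord _ u)) ∘L _ = _ at this
  rw [e] at this
  exact ⟨_, this⟩

open Classical in
/-- The inverse of the coordinate map `coord φ`. -/
def ofCoord (φ : OpenPartialHomeomorph M (V m)) (p : JetModel m) : JetBundle m M :=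
  let u : FrameBundle m M := FrameBundle.ofCoord φ (p.1, p.2.1)
  let l : V m →L[ℝ] FrameModel m := FrameBundle.liftOf (M := M) φ (p.1, p.2.1) p.2.2
  if h : FrameBundle.DBase u ∘L l = ContinuousLinearMap.id ℝ (V m) then ⟨u, l, h⟩
  else ⟨u, (exists_lift u).choose, (exists_lift u).choose_spec⟩

variable {φ ψ : OpenPartialHomeomorph M (V m)}

theorem ofCoord_pt (p : JetModel m) :
    (ofCoord (M := M) φ p).pt = FrameBundle.ofCoord φ (p.1, p.2.1) := by
  unfold ofCoord
  dsimp only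
  split_ifs <;> rfl

theorem ofCoord_eq (hφ : φ ∈ IsManifold.maximalAtlas (𝓡 m) ∞ M) {p : JetModel m}
    (hp : p.1 ∈ φ.target ∧ p.2.1.IsInvertible) :
    ofCoord (M := M) φ p = ⟨FrameBundle.ofCoord φ (p.1, p.2.1),
      FrameBundle.liftOf (M := M) φ (p.1, p.2.1) p.2.2, FrameBundle.DBase_liftOf hφ hp p.2.2⟩ :=
  dif_pos _

/-- The fibered chart `(x^μ, e^ν_k, e^ν_{kσ})` of `J¹τ` induced by a chart of `M`. -/
def chart (φ : OpenPartialHomeomorph M (V m)) (hφ : φ ∈ IsManifold.maximalAtlas (𝓡 m) ∞ M) :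
    PartialEquiv (JetBundle m M) (JetModel m) where
  toFun := coord φ
  invFun := ofCoord φ
  source := {ρ | ρ.pt.base ∈ φ.source}
  target := {p | p.1 ∈ φ.target ∧ p.2.1.IsInvertible}
  map_source' ρ hρ := (FrameBundle.chart φ hφ).map_source hρ
  map_target' p hp := by
    rw [ofCoord_eq hφ hp]
    exact φ.map_target hp.1
  left_inv' ρ hρ := by
    have hp := (FrameBundle.chart φ hφ).map_source hρ
    have hpt : FrameBundle.ofCoord φ (FrameBundle.coord φ ρ.pt) = ρ.pt :=
      (FrameBundle.chart φ hφ).left_inv hρ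
    rw [ofCoord_eq hφ (p := coord φ ρ) hp]
    refine ext' hpt fun w => ?_
    have h1 : FrameBundle.DBase ρ.pt (ρ.lift w) = w := DFunLike.congr_fun ρ.proj w
    have h2 := FrameBundle.D_fst hφ hρ (ρ.lift w)
    rw [h1] at h2
    rw [← FrameBundle.DInv_D hφ hρ (ρ.lift w)]
    change FrameBundle.DInv φ (FrameBundle.coord φ ρ.pt) _ = _
    congr 1
    have h3 : φ.symm (φ ρ.pt.base) = ρ.pt.base := φ.left_inv hρ
    refine Prod.ext ?_ ?_
    · change (mfderiv (𝓡 m) (𝓡 m) φ (φ.symm (φ ρ.pt.base)) : V m →L[ℝ] V m) w = _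
      rw [h2, h3]
    · change (FrameBundle.D φ ρ.pt (ρ.lift
        ((mfderiv (𝓡 m) (𝓡 m) φ.symm (φ ρ.pt.base) : V m →L[ℝ] V m)
          ((mfderiv (𝓡 m) (𝓡 m) φ (φ.symm (φ ρ.pt.base)) : V m →L[ℝ] V m) w)))).2 = _
      rw [h3]
      exact congrArg (fun z => (FrameBundle.D φ ρ.pt (ρ.lift z)).2)
        (FrameBundle.D_symm_D hφ hρ w)
  right_inv' p hp := by
    rw [ofCoord_eq hφ hp]
    have h := (FrameBundle.chart φ hφ).right_inv
      (show (p.1, p.2.1) ∈ (FrameBundle.chart φ hφ).target from hp)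
    have e1 : φ (φ.symm p.1) = p.1 := φ.right_inv hp.1
    refine Prod.ext e1 (Prod.ext (congrArg Prod.snd h) ?_)
    ext1 w
    change (FrameBundle.D φ (FrameBundle.ofCoord φ (p.1, p.2.1))
      (FrameBundle.DInv (M := M) φ (p.1, p.2.1) _)).2 = _
    rw [FrameBundle.D_DInv hφ (p := (p.1, p.2.1)) hp]
    change p.2.2 ((mfderiv (𝓡 m) (𝓡 m) φ (φ.symm p.1) : V m →L[ℝ] V m)
      ((mfderiv (𝓡 m) (𝓡 m) φ.symm (φ (φ.symm p.1)) : V m →L[ℝ] V m) w)) = _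
    rw [e1]
    exact congrArg p.2.2 (FrameBundle.D_D_symm hφ hp.1 w)

theorem chart_trans_source (hφ : φ ∈ IsManifold.maximalAtlas (𝓡 m) ∞ M)
    (hψ : ψ ∈ IsManifold.maximalAtlas (𝓡 m) ∞ M) :
    ((chart φ hφ).symm.trans (chart ψ hψ)).source =
      {p | (p.1, p.2.1) ∈ (φ.symm ≫ₕ ψ).source ×ˢ {A : V m →L[ℝ] V m | A.IsInvertible}} := by
  ext p
  change ((p.1 ∈ φ.target ∧ p.2.1.IsInvertible) ∧ (ofCoord (M := M) φ p).pt.base ∈ ψ.source) ↔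
    (p.1 ∈ φ.target ∧ φ.symm p.1 ∈ ψ.source) ∧ p.2.1.IsInvertible
  rw [ofCoord_pt]
  change ((p.1 ∈ φ.target ∧ p.2.1.IsInvertible) ∧ φ.symm p.1 ∈ ψ.source) ↔ _
  tauto

theorem isOpen_chart_trans_source (hφ : φ ∈ IsManifold.maximalAtlas (𝓡 m) ∞ M)
    (hψ : ψ ∈ IsManifold.maximalAtlas (𝓡 m) ∞ M) :
    IsOpen ((chart φ hφ).symm.trans (chart ψ hψ)).source := by
  rw [chart_trans_source]
  exact ((φ.symm ≫ₕ ψ).open_source.prod FrameBundle.isOpen_isInvertible).preimage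
    (f := fun p : JetModel m => ((p.1, p.2.1) : FrameModel m)) (by fun_prop)

theorem chart_trans_apply (hφ : φ ∈ IsManifold.maximalAtlas (𝓡 m) ∞ M)
    (hψ : ψ ∈ IsManifold.maximalAtlas (𝓡 m) ∞ M) {p : JetModel m}
    (hp : (p.1, p.2.1) ∈ (φ.symm ≫ₕ ψ).source ×ˢ {A : V m →L[ℝ] V m | A.IsInvertible}) :
    coord ψ (ofCoord φ p) = ((ψ ∘ φ.symm) p.1, fderiv ℝ (ψ ∘ φ.symm) p.1 ∘L p.2.1,
      ContinuousLinearMap.snd ℝ (V m) (V m →L[ℝ] V m) ∘L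
        fderiv ℝ (FrameBundle.coord ψ ∘ FrameBundle.ofCoord φ) (p.1, p.2.1) ∘L
          (ContinuousLinearMap.id ℝ (V m)).prod p.2.2 ∘L
            fderiv ℝ (φ ∘ ψ.symm) ((ψ ∘ φ.symm) p.1)) := by
  have hp1 : p.1 ∈ φ.target ∧ φ.symm p.1 ∈ ψ.source := by simpa using hp.1
  have hp' : p.1 ∈ φ.target ∧ p.2.1.IsInvertible := ⟨hp1.1, hp.2⟩
  rw [ofCoord_eq hφ hp']
  refine Prod.ext rfl (Prod.ext (congrArg Prod.snd (FrameBundle.chart_trans_apply hφ hψ hp)) ?_)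
  ext1 w
  have e : ψ.symm (ψ (φ.symm p.1)) = φ.symm p.1 := ψ.left_inv hp1.2
  have h1 : ψ (φ.symm p.1) ∈ (ψ.symm ≫ₕ φ).source := by
    simp [hp1.2, hp1.1]
  have h2 := chart_fderiv_transition hψ hφ h1
  have hF : (p.1, p.2.1) ∈
      ((FrameBundle.openChart φ hφ).symm ≫ₕ (FrameBundle.openChart ψ hψ)).source := by
    change _ ∈ ((FrameBundle.chart φ hφ).symm.trans (FrameBundle.chart ψ hψ)).source
    rw [FrameBundle.chart_trans_source]
    exact hp
  have h3 : FrameBundle.D ψ (FrameBundle.ofCoord (M := M) φ (p.1, p.2.1)) ∘L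
      FrameBundle.DInv (M := M) φ (p.1, p.2.1) =
        fderiv ℝ (FrameBundle.coord ψ ∘ FrameBundle.ofCoord φ) (p.1, p.2.1) :=
    chart_fderiv_transition (FrameBundle.openChart_mem hφ) (FrameBundle.openChart_mem hψ) hF
  rw [← h3]
  change _ = (FrameBundle.D ψ _ (FrameBundle.DInv (M := M) φ (p.1, p.2.1)
    ((ContinuousLinearMap.id ℝ (V m)).prod p.2.2
      (fderiv ℝ (φ ∘ ψ.symm) (ψ (φ.symm p.1)) w)))).2
  rw [← h2, e]
  rfl

theorem contDiffOn_chart_trans (hφ : φ ∈ IsManifold.maximalAtlas (𝓡 m) ∞ M)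
    (hψ : ψ ∈ IsManifold.maximalAtlas (𝓡 m) ∞ M) :
    ContDiffOn ℝ ∞ ((chart φ hφ).symm.trans (chart ψ hψ))
      ((chart φ hφ).symm.trans (chart ψ hψ)).source := by
  rw [chart_trans_source]
  set S : Set (JetModel m) :=
    {p | (p.1, p.2.1) ∈ (φ.symm ≫ₕ ψ).source ×ˢ {A : V m →L[ℝ] V m | A.IsInvertible}}
  have hf := chart_transition hφ hψ
  have hf' := chart_transition hψ hφ
  have hG : ContDiffOn ℝ ∞ (FrameBundle.coord ψ ∘ FrameBundle.ofCoord (M := M) φ)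
      ((FrameBundle.chart φ hφ).symm.trans (FrameBundle.chart ψ hψ)).source :=
    FrameBundle.contDiffOn_chart_trans hφ hψ
  have hG' := hG.fderiv_of_isOpen (m := ∞) (FrameBundle.isOpen_chart_trans_source hφ hψ) (by simp)
  have m1 : MapsTo (Prod.fst : JetModel m → V m) S (φ.symm ≫ₕ ψ).source := fun p hp => hp.1
  have m2 : MapsTo (fun p : JetModel m => ((p.1, p.2.1) : FrameModel m)) S
      ((FrameBundle.chart φ hφ).symm.trans (FrameBundle.chart ψ hψ)).source := by
    rw [FrameBundle.chart_trans_source]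
    exact fun p hp => hp
  have m3 : MapsTo (fun p : JetModel m => (ψ ∘ φ.symm) p.1) S (ψ.symm ≫ₕ φ).source := by
    intro p hp
    have hp1 : p.1 ∈ φ.target ∧ φ.symm p.1 ∈ ψ.source := by simpa using hp.1
    simp [hp1.1, hp1.2]
  have c1 : ContDiffOn ℝ ∞ (fun p : JetModel m => (ψ ∘ φ.symm) p.1) S :=
    hf.comp contDiffOn_fst m1
  have c2 : ContDiffOn ℝ ∞ (fun p : JetModel m => fderiv ℝ (ψ ∘ φ.symm) p.1) S :=
    (hf.fderiv_of_isOpen (φ.symm ≫ₕ ψ).open_source (by simp)).comp contDiffOn_fst m1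
  have c3 : ContDiffOn ℝ ∞ (fun p : JetModel m =>
      fderiv ℝ (FrameBundle.coord ψ ∘ FrameBundle.ofCoord (M := M) φ) (p.1, p.2.1)) S :=
    hG'.comp (f := fun p : JetModel m => ((p.1, p.2.1) : FrameModel m)) (by fun_prop) m2
  have c4 : ContDiffOn ℝ ∞ (fun p : JetModel m =>
      fderiv ℝ (φ ∘ ψ.symm) ((ψ ∘ φ.symm) p.1)) S :=
    (hf'.fderiv_of_isOpen (ψ.symm ≫ₕ φ).open_source (by simp)).comp c1 m3
  have c5 : ContDiffOn ℝ ∞ (fun p : JetModel m =>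
      (ContinuousLinearMap.id ℝ (V m)).prod p.2.2) S := by
    have h : (fun p : JetModel m => (ContinuousLinearMap.id ℝ (V m)).prod p.2.2) = fun p =>
        ContinuousLinearMap.inl ℝ (V m) (V m →L[ℝ] V m) ∘L ContinuousLinearMap.id ℝ (V m) +
          ContinuousLinearMap.inr ℝ (V m) (V m →L[ℝ] V m) ∘L p.2.2 := by
      funext p
      ext w <;> simp
    rw [h]
    exact (contDiff_const.add (contDiff_const.clm_comp contDiff_snd.snd)).contDiffOn
  refine ContDiffOn.congr ?_ fun p hp => chart_trans_apply hφ hψ hp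
  exact c1.prodMk ((c2.clm_comp contDiff_snd.fst.contDiffOn).prodMk
    (contDiffOn_const.clm_comp (c3.clm_comp (c5.clm_comp c4))))

variable (m M) in
/-- The smooth structure of `J¹τ`, given by the fibered charts induced by all charts of `M`. -/
def smoothAtlas : SmoothAtlas (JetModel m) (JetBundle m M) where
  charts := {e | ∃ φ hφ, e = chart φ hφ}
  chartAt ρ := chart (chartAt (V m) ρ.pt.base) (IsManifold.chart_mem_maximalAtlas ρ.pt.base)
  mem_source ρ := mem_chart_source (V m) ρ.pt.base
  chartAt_mem ρ := ⟨_, _, rfl⟩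
  isOpen := by
    rintro _ ⟨φ, hφ, rfl⟩ _ ⟨ψ, hψ, rfl⟩
    exact isOpen_chart_trans_source hφ hψ
  contDiffOn := by
    rintro _ ⟨φ, hφ, rfl⟩ _ ⟨ψ, hψ, rfl⟩
    exact contDiffOn_chart_trans hφ hψ

instance : TopologicalSpace (JetBundle m M) := (smoothAtlas m M).core.toTopologicalSpace

instance : ChartedSpace (JetModel m) (JetBundle m M) := (smoothAtlas m M).core.toChartedSpace

instance : IsManifold 𝓘(ℝ, JetModel m) ∞ (JetBundle m M) := (smoothAtlas m M).isManifold

/-- The 1-jet `j¹_x s` of a local section `s` of `τ`. -/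
def jet (s : M → FrameBundle m M) (x : M) (hs : MDifferentiableAt (𝓡 m) 𝓘(ℝ, FrameModel m) s x)
    (hsec : ∀ᶠ y in nhds x, (s y).base = y) : JetBundle m M where
  pt := s x
  lift := (mfderiv (𝓡 m) 𝓘(ℝ, FrameModel m) s x : V m →L[ℝ] FrameModel m)
  proj := by
    have h1 := mfderiv_comp x
      ((FrameBundle.contMDiff_base (s x)).mdifferentiableAt (by simp)) hs
    have h2 : FrameBundle.base ∘ s =ᶠ[nhds x] id := hsec
    rw [h2.mfderiv_eq, mfderiv_id] at h1
    exact h1.symm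

/-- Every element of `J¹τ` is the 1-jet of a smooth local section. -/
theorem exists_jet_eq (ρ : JetBundle m M) : ∃ (s : M → FrameBundle m M)
    (hs : MDifferentiableAt (𝓡 m) 𝓘(ℝ, FrameModel m) s ρ.pt.base)
    (hsec : ∀ᶠ y in nhds ρ.pt.base, (s y).base = y),
    ContMDiffAt (𝓡 m) 𝓘(ℝ, FrameModel m) ∞ s ρ.pt.base ∧ jet s ρ.pt.base hs hsec = ρ := by
  set x := ρ.pt.base with hx
  set φ := chartAt (V m) x
  have hφ : φ ∈ IsManifold.maximalAtlas (𝓡 m) ∞ M := IsManifold.chart_mem_maximalAtlas x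
  have hxs : x ∈ φ.source := mem_chart_source (V m) x
  obtain ⟨p, hp⟩ : ∃ p, p = coord φ ρ := ⟨_, rfl⟩
  have hpt : p ∈ (chart φ hφ).target := hp ▸ (chart φ hφ).map_source (x := ρ) hxs
  have hp1 : p.1 = φ x := by rw [hp]; rfl
  have hρ : ofCoord φ p = ρ := hp ▸ (chart φ hφ).left_inv (x := ρ) hxs
  set g : V m → FrameModel m := fun y => (y, p.2.1 + p.2.2 (y - φ x))
  have hg : ContDiff ℝ ∞ g := by fun_prop
  have hgx : g (φ x) = (p.1, p.2.1) := by simp [g, hp1]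
  have hgd : HasFDerivAt g ((ContinuousLinearMap.id ℝ (V m)).prod p.2.2) (φ x) := by
    refine (hasFDerivAt_id _).prodMk ?_
    exact (p.2.2.hasFDerivAt.comp (φ x) ((hasFDerivAt_id _).sub_const _)).const_add _
  have hφm : ContMDiffAt (𝓡 m) (𝓡 m) ∞ φ x :=
    (contMDiffOn_of_mem_maximalAtlas hφ).contMDiffAt (φ.open_source.mem_nhds hxs)
  have htgt : g (φ x) ∈ (FrameBundle.openChart φ hφ).target := by rw [hgx]; exact hpt
  have hgm : ContMDiffAt (𝓡 m) 𝓘(ℝ, FrameModel m) ∞ (g ∘ φ) x :=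
    hg.contMDiff.contMDiffAt.comp x hφm
  have hF := contMDiffOn_symm_of_mem_maximalAtlas (FrameBundle.openChart_mem hφ)
  have hF' := hF.contMDiffAt ((FrameBundle.openChart φ hφ).open_target.mem_nhds htgt)
  have hs : ContMDiffAt (𝓡 m) 𝓘(ℝ, FrameModel m) ∞
      ((FrameBundle.openChart φ hφ).symm ∘ (g ∘ φ)) x := hF'.comp x hgm
  have hsec : ∀ᶠ y in nhds x, ((FrameBundle.ofCoord φ ∘ (g ∘ φ)) y).base = y := by
    filter_upwards [φ.open_source.mem_nhds hxs] with y hy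
    exact φ.left_inv hy
  refine ⟨FrameBundle.ofCoord φ ∘ (g ∘ φ), hs.mdifferentiableAt (by simp), hsec, hs, ?_⟩
  have e0 := mfderiv_comp x (hF'.mdifferentiableAt (by simp)) (hgm.mdifferentiableAt (by simp))
  have e1 := mfderiv_comp x (hg.contMDiff.contMDiffAt.mdifferentiableAt (by simp))
    (hφm.mdifferentiableAt (by simp))
  rw [e1, mfderiv_eq_fderiv, hgd.fderiv] at e0
  refine Eq.trans ?_ hρ
  rw [ofCoord_eq hφ hpt]
  refine ext' (congrArg (FrameBundle.ofCoord φ) hgx) fun w => ?_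
  refine (DFunLike.congr_fun e0 w).trans ?_
  change FrameBundle.DInv (M := M) φ (g (φ x))
    ((ContinuousLinearMap.id ℝ (V m)).prod p.2.2 ((mfderiv (𝓡 m) (𝓡 m) φ x : V m →L[ℝ] V m) w)) =
    FrameBundle.DInv (M := M) φ (p.1, p.2.1) ((ContinuousLinearMap.id ℝ (V m)).prod p.2.2
      ((mfderiv (𝓡 m) (𝓡 m) φ (φ.symm p.1) : V m →L[ℝ] V m) w))
  rw [hgx, hp1, φ.left_inv hxs]

end JetBundle

namespace FrameBundle
variable {m : ℕ} {M : Type*} [TopologicalSpace M] [ChartedSpace (V m) M]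

/-- The right action of `GL(m)` on `LM`, `u · g = u ∘ g`. -/
def act (u : FrameBundle m M) (g : (V m →L[ℝ] V m)ˣ) : FrameBundle m M :=
  ⟨u.base, (ContinuousLinearEquiv.unitsEquiv ℝ (V m) g).trans u.frame⟩

variable [IsManifold (𝓡 m) ∞ M]

/-- The infinitesimal generators of the action: the differential at the identity of the orbit map
`g ↦ u · g`, as a map from the Lie algebra `gl(m)` to `T_u LM`. -/
def generator (u : FrameBundle m M) :
    (V m →L[ℝ] V m) →L[ℝ] TangentSpace 𝓘(ℝ, FrameModel m) u :=
  mfderiv 𝓘(ℝ, V m →L[ℝ] V m) 𝓘(ℝ, FrameModel m) u.act (1 : (V m →L[ℝ] V m)ˣ)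

/-- The vertical subspace of `T_u LM`. -/
def vertical (u : FrameBundle m M) : Submodule ℝ (TangentSpace 𝓘(ℝ, FrameModel m) u) :=
  (mfderiv 𝓘(ℝ, FrameModel m) (𝓡 m) (base : FrameBundle m M → M) u).ker

theorem D_generator (u : FrameBundle m M) (A : V m →L[ℝ] V m) :
    D (chartAt (V m) u.base) u (u.generator A) =
      (0, (coord (chartAt (V m) u.base) u).2 ∘L A) := by
  set φ := chartAt (V m) u.base
  have hφ : φ ∈ IsManifold.maximalAtlas (𝓡 m) ∞ M := IsManifold.chart_mem_maximalAtlas u.base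
  have hu : u.base ∈ φ.source := mem_chart_source (V m) u.base
  set B := (coord φ u).2 with hB
  have hBi : B.IsInvertible := ((chart φ hφ).map_source (x := u) hu).2
  set L : (V m →L[ℝ] V m) → FrameModel m := fun a => (φ u.base, B ∘L a)
  have hL : ContDiff ℝ ∞ L := contDiff_const.prodMk (contDiff_const.clm_comp contDiff_id)
  have h1 : coord φ ∘ u.act = L ∘ Units.val := rfl
  have hval : MDifferentiableAt 𝓘(ℝ, V m →L[ℝ] V m) 𝓘(ℝ, V m →L[ℝ] V m)
      (Units.val : (V m →L[ℝ] V m)ˣ → _) 1 :=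
    (Units.contMDiff_val (n := ∞)).mdifferentiableAt (by simp)
  have hval' : mfderiv 𝓘(ℝ, V m →L[ℝ] V m) 𝓘(ℝ, V m →L[ℝ] V m)
      (Units.val : (V m →L[ℝ] V m)ˣ → _) 1 = ContinuousLinearMap.id ℝ (V m →L[ℝ] V m) := 
    mfderiv_extChartAt_self (I := 𝓘(ℝ, V m →L[ℝ] V m)) (x := (1 : (V m →L[ℝ] V m)ˣ))
  have hact : u.act = (openChart φ hφ).symm ∘ L ∘ Units.val := by
    funext g
    exact ((chart φ hφ).left_inv (x := u.act g) hu).symm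
  have hLm : MDifferentiableAt 𝓘(ℝ, V m →L[ℝ] V m) 𝓘(ℝ, FrameModel m) L
      ((1 : (V m →L[ℝ] V m)ˣ) : V m →L[ℝ] V m) :=
    (hL.differentiable (by simp)).differentiableAt.mdifferentiableAt
  have hLv := hLm.comp (1 : (V m →L[ℝ] V m)ˣ) hval
  have hmem : (L ∘ Units.val) (1 : (V m →L[ℝ] V m)ˣ) ∈ (openChart φ hφ).target :=
    ⟨φ.map_source hu, hBi⟩
  have hact' : MDifferentiableAt 𝓘(ℝ, V m →L[ℝ] V m) 𝓘(ℝ, FrameModel m) u.act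
      (1 : (V m →L[ℝ] V m)ˣ) := by
    rw [hact]
    exact ((chart_mdifferentiable (openChart_mem hφ)).mdifferentiableAt_symm hmem).comp _ hLv
  have hone : u.act 1 = u := ext' rfl fun w => rfl
  have hc : MDifferentiableAt 𝓘(ℝ, FrameModel m) 𝓘(ℝ, FrameModel m) (coord φ) (u.act 1) :=
    (chart_mdifferentiable (openChart_mem hφ)).mdifferentiableAt hu
  have e1 := mfderiv_comp (1 : (V m →L[ℝ] V m)ˣ) hc hact'
  have e2 := mfderiv_comp (1 : (V m →L[ℝ] V m)ˣ) hLm hval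
  rw [h1, e2] at e1
  have e3 := DFunLike.congr_fun e1 A
  have hLd : HasFDerivAt L ((0 : (V m →L[ℝ] V m) →L[ℝ] V m).prod
      (ContinuousLinearMap.compL ℝ (V m) (V m) (V m) B)) (1 : V m →L[ℝ] V m) :=
    (hasFDerivAt_const _ _).prodMk (ContinuousLinearMap.compL ℝ (V m) (V m) (V m) B).hasFDerivAt
  rw [hval', mfderiv_eq_fderiv] at e3
  have e4 : fderiv ℝ L ((1 : (V m →L[ℝ] V m)ˣ) : V m →L[ℝ] V m) A = (0, B ∘L A) := by
    rw [Units.val_one, hLd.fderiv]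
    rfl
  have e5 : (mfderiv 𝓘(ℝ, FrameModel m) 𝓘(ℝ, FrameModel m) (coord φ) (u.act 1) :
    FrameModel m →L[ℝ] FrameModel m) = D φ u := by rw [hone]; rfl
  rw [← e4, ← e5]
  exact e3.symm

theorem D_injective {φ : OpenPartialHomeomorph M (V m)}
    (hφ : φ ∈ IsManifold.maximalAtlas (𝓡 m) ∞ M) {u : FrameBundle m M}
    (hu : u.base ∈ φ.source) : Function.Injective (D φ u) :=
  Function.LeftInverse.injective (g := DInv (M := M) φ (coord φ u)) (DInv_D hφ hu)

theorem generator_mem (u : FrameBundle m M) (A : V m →L[ℝ] V m) : u.generator A ∈ u.vertical := by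
  have hφ : chartAt (V m) u.base ∈ IsManifold.maximalAtlas (𝓡 m) ∞ M :=
    IsManifold.chart_mem_maximalAtlas u.base
  have hu : u.base ∈ (chartAt (V m) u.base).source := mem_chart_source (V m) u.base
  have h := D_fst hφ hu (u.generator A)
  rw [D_generator] at h
  have h0 : (mfderiv (𝓡 m) (𝓡 m) (chartAt (V m) u.base) u.base : V m →L[ℝ] V m) 0 = 0 :=
    ContinuousLinearMap.map_zero _
  exact (chart_mdifferentiable hφ).mfderiv_injective hu (h.symm.trans h0.symm)

/-- The identification of `gl(m)` with the vertical subspace at `u` given by the infinitesimal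
generators of the action. -/
def verticalEquiv (u : FrameBundle m M) : (V m →L[ℝ] V m) ≃ₗ[ℝ] u.vertical :=
  LinearEquiv.ofBijective
    (LinearMap.codRestrict u.vertical u.generator.toLinearMap u.generator_mem) <| by
    have hφ : chartAt (V m) u.base ∈ IsManifold.maximalAtlas (𝓡 m) ∞ M :=
      IsManifold.chart_mem_maximalAtlas u.base
    have hu : u.base ∈ (chartAt (V m) u.base).source := mem_chart_source (V m) u.base
    have hB : (coord (chartAt (V m) u.base) u).2.IsInvertible :=
      ((chart _ hφ).map_source (x := u) hu).2
    constructor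
    · intro A A' h
      have h1 : u.generator A = u.generator A' := congrArg Subtype.val h
      have h2 := D_generator u A
      rw [h1, D_generator u A'] at h2
      have h3 := congrArg Prod.snd h2
      ext1 w
      exact hB.injective (DFunLike.congr_fun h3 w).symm
    · rintro ⟨Y, hY⟩
      set B := (coord (chartAt (V m) u.base) u).2
      refine ⟨B.inverse ∘L (D (chartAt (V m) u.base) u Y).2, Subtype.ext ?_⟩
      apply D_injective hφ hu
      change D _ u (u.generator _) = _
      rw [D_generator]
      refine Prod.ext ?_ ?_
      · have hY' : DBase u Y = 0 := hY
        change 0 = (D (chartAt (V m) u.base) u Y).1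
        have h := D_fst hφ hu Y
        rw [hY'] at h
        exact (h.trans (ContinuousLinearMap.map_zero
          (mfderiv (𝓡 m) (𝓡 m) (chartAt (V m) u.base) u.base))).symm
      · ext1 w
        exact hB.self_apply_inverse _

end FrameBundle

section Forms

variable {F F' N N' W : Type*} [NormedAddCommGroup F] [NormedSpace ℝ F]
  [NormedAddCommGroup F'] [NormedSpace ℝ F'] [NormedAddCommGroup W] [NormedSpace ℝ W]
  [TopologicalSpace N] [ChartedSpace F N] [TopologicalSpace N'] [ChartedSpace F' N']

/-- Differential `k`-forms (not necessarily smooth) on a manifold, with values in `W`. -/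
abbrev DiffForm (F N W : Type*) [NormedAddCommGroup F] [NormedSpace ℝ F] [NormedAddCommGroup W]
    [NormedSpace ℝ W] [TopologicalSpace N] [ChartedSpace F N] (k : ℕ) :=
  ∀ x : N, TangentSpace 𝓘(ℝ, F) x [⋀^Fin k]→L[ℝ] W

/-- The pullback `f^* α`. -/
def DiffForm.pullback {k : ℕ} (f : N → N') (α : DiffForm F' N' W k) : DiffForm F N W k :=
  fun x => (α (f x)).compContinuousLinearMap (mfderiv 𝓘(ℝ, F) 𝓘(ℝ, F') f x)

/-- The exterior derivative, computed at each point in the preferred chart at this point. -/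
def DiffForm.d {k : ℕ} (α : DiffForm F N W k) : DiffForm F N W (k + 1) := fun x =>
  let αloc : F → F [⋀^Fin k]→L[ℝ] W := DiffForm.pullback (chartAt F x).symm α
  (extDeriv αloc (chartAt F x x)).compContinuousLinearMap
    (mfderiv 𝓘(ℝ, F) 𝓘(ℝ, F) (chartAt F x) x)

/-- The wedge product, at a point, of an `End(W)`-valued 1-form and a `W`-valued `k`-form, for the
natural action of `End(W)` on `W`: its value at `(X_0, …, X_k)` is the sum over `i` of
`(-1)^i w(X_i) α(X_0, …, X_{i-1}, X_{i+1}, …, X_k)`. -/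
def wedgeAct {k : ℕ} (w : F →L[ℝ] W →L[ℝ] W) (α : F [⋀^Fin k]→L[ℝ] W) :
    F [⋀^Fin (k + 1)]→L[ℝ] W :=
  ContinuousAlternatingMap.alternatizeUncurryFin
    ((ContinuousLinearMap.compContinuousAlternatingMapCLM ℝ F W W (Fin k)).flip α ∘L w)

/-- The wedge product of forms on a manifold, for the natural action of `End(W)` on `W`. -/
def DiffForm.wedgeAct {k : ℕ} (w : ∀ x : N, TangentSpace 𝓘(ℝ, F) x →L[ℝ] W →L[ℝ] W)
    (α : DiffForm F N W k) : DiffForm F N W (k + 1) := fun x =>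
  (FrameJet.wedgeAct (F := F) (w x) (α x) : F [⋀^Fin (k + 1)]→L[ℝ] W)

/-- A linear map between finite-dimensional spaces, as a continuous linear map. -/
def toCLM [FiniteDimensional ℝ F] (l : F →ₗ[ℝ] W) : F →L[ℝ] W :=
  LinearMap.toContinuousLinearMap l

end Forms

section Torsion

variable {m : ℕ} {M : Type*} [TopologicalSpace M] [ChartedSpace (V m) M] [IsManifold (𝓡 m) ∞ M]

/-- The canonical form of `LM`: `X ↦ u⁻¹ (T_u τ (X))`. -/
def FrameBundle.canonicalForm : DiffForm (FrameModel m) (FrameBundle m M) (V m) 1 := fun u =>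
  ContinuousAlternatingMap.ofSubsingleton ℝ _ (V m) (0 : Fin 1)
    (u.frame.symm.toContinuousLinearMap.comp
      (mfderiv 𝓘(ℝ, FrameModel m) (𝓡 m) (FrameBundle.base : FrameBundle m M → M) u))

namespace JetBundle

/-- The canonical form `θ` of `J¹τ`, the pullback of that of `LM`. -/
def canonicalForm : DiffForm (JetModel m) (JetBundle m M) (V m) 1 :=
  DiffForm.pullback (JetBundle.pt : JetBundle m M → FrameBundle m M) FrameBundle.canonicalForm

/-- The vertical projection `Γ_u = id - ρ ∘ T_u τ` defined by a jet `ρ` over `u`. -/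
def verticalProj (ρ : JetBundle m M) :
    TangentSpace 𝓘(ℝ, FrameModel m) ρ.pt →ₗ[ℝ] ρ.pt.vertical :=
  LinearMap.codRestrict ρ.pt.vertical
    (LinearMap.id - (ρ.lift.comp
      (mfderiv 𝓘(ℝ, FrameModel m) (𝓡 m) FrameBundle.base ρ.pt)).toLinearMap) <| by
    intro Y
    have h := DFunLike.congr_fun ρ.proj (FrameBundle.DBase ρ.pt Y)
    change FrameBundle.DBase ρ.pt (Y - ρ.lift (FrameBundle.DBase ρ.pt Y)) = 0
    exact ((FrameBundle.DBase ρ.pt).map_sub _ _).trans (sub_eq_zero.mpr h.symm)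

/-- The universal connection form `ω`, with values in `gl(m)`: at `ρ` over `u` it sends `Y` to the
element of `gl(m)` generating the vertical vector `Γ_u (Tτ₁₀ (Y))`. -/
def connectionForm (ρ : JetBundle m M) :
    TangentSpace 𝓘(ℝ, JetModel m) ρ →L[ℝ] V m →L[ℝ] V m :=
  let w : JetModel m →ₗ[ℝ] V m →L[ℝ] V m :=
    ρ.pt.verticalEquiv.symm.toLinearMap ∘ₗ ρ.verticalProj ∘ₗ
      (mfderiv 𝓘(ℝ, JetModel m) 𝓘(ℝ, FrameModel m)
        (JetBundle.pt : JetBundle m M → FrameBundle m M) ρ).toLinearMap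
  toCLM (F := JetModel m) (W := V m →L[ℝ] V m) w

/-- The universal torsion `T = dθ + ω ∧ θ`. -/
def torsion : DiffForm (JetModel m) (JetBundle m M) (V m) 2 := fun ρ =>
  canonicalForm.d ρ + DiffForm.wedgeAct connectionForm canonicalForm ρ

/-- The matrix `(e^μ_k)` of a jet in a chart of `M`. -/
def e (φ : OpenPartialHomeomorph M (V m)) (ρ : JetBundle m M) : Matrix (Fin m) (Fin m) ℝ :=
  fun μ k => (coord φ ρ).2.1 (EuclideanSpace.single k 1) μ

/-- The coordinates `e^μ_{kσ}` of a jet in a chart of `M`. -/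
def e₁ (φ : OpenPartialHomeomorph M (V m)) (ρ : JetBundle m M) (μ k σ : Fin m) : ℝ :=
  (coord φ ρ).2.2 (EuclideanSpace.single σ 1) (EuclideanSpace.single k 1) μ

/-- The equations `e^μ_{iν} e^i_σ - e^μ_{iσ} e^i_ν = 0` in a chart of `M`, where `(e^i_σ)` is the
inverse matrix of `(e^μ_i)`. -/
def LocalEquations (φ : OpenPartialHomeomorph M (V m)) (ρ : JetBundle m M) : Prop :=
  ∀ μ ν σ : Fin m,
    ∑ i, e₁ φ ρ μ i ν * (e φ ρ)⁻¹ i σ - ∑ i, e₁ φ ρ μ i σ * (e φ ρ)⁻¹ i ν = 0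

end JetBundle

end Torsion

end FrameJet

end

/-! Let a jet have coordinates `(x, B, P)` in a chart of `M`, with `B` the matrix `e^μ_k` and `P`
the array `e^μ_{kσ}`, and put `Q = P ∘ B`, so that `Q a b = P (B a) b`. Contracting the two lower
indices of the local equations with `B` turns them into the linear condition `Q a b = Q b a`.

Independence of the chart (`coord_change`): under a transition map `f`, the new `Q` is `D²f (B a, B
b) + Df (Q a b)`. The inhomogeneous term is symmetric, so symmetry of `Q` passes from one chart to
another. Hence the local equations define a global subset `torsionFree`.

Submanifold (`exists_slice_chart`, `exists_submanifold_of_slice_charts`): since `B` is invertible,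
`(x, B, P) ↦ (x, B, Q)` is a diffeomorphism onto its image, and composing it with the fibered charts
gives charts of `J¹τ` in which the subset is a fixed linear subspace. Such slice charts make it an
embedded submanifold.

Torsion (`torsion_apply`): in coordinates `θ = B⁻¹ dx` and `ω = B⁻¹ (dB - P dx)`. The terms in `dB`
of `dθ` and of `ω ∧ θ` cancel, which leaves the antisymmetrization of `-B⁻¹ P(dx) B⁻¹ dx`. Evaluated
on two vectors it is `B⁻¹` applied to the antisymmetric part of `Q` at their images under `θ`. So
`T` vanishes at every jet of the subset, on all tangent vectors, and therefore so does its pullback.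
-/

noncomputable section

namespace FrameJet

/-! ### Submanifolds defined by slice charts -/

section Slice

variable {E G N : Type*} [NormedAddCommGroup E] [NormedSpace ℝ E] [NormedAddCommGroup G]
  [NormedSpace ℝ G] [TopologicalSpace N]

open Classical in
/-- A chart of the ambient space in which a subset `T` is the range of a split linear injection `J`
restricts to a chart of `T`. -/
def sliceChart {T : Set N} (J : G →L[ℝ] E) (L : E →L[ℝ] G) (hLJ : ∀ y, L (J y) = y)
    (χ : OpenPartialHomeomorph N E) (hχ : ∀ x ∈ χ.source, x ∈ T ↔ χ x ∈ range J) (x₀ : T) :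
    OpenPartialHomeomorph T G where
  toFun t := L (χ t)
  -- Membership in `T` is only known when `J y` lies in the target of `χ`. Elsewhere `x₀` is a
  -- default value, whose sole role is to make the inverse a total function into `T`.
  invFun y := if h : J y ∈ χ.target then
    ⟨χ.symm (J y), (hχ _ (χ.map_target h)).2 (by rw [χ.right_inv h]; exact mem_range_self y)⟩
    else x₀
  source := Subtype.val ⁻¹' χ.source
  target := J ⁻¹' χ.target
  map_source' t ht := by
    obtain ⟨y, hy⟩ := (hχ t ht).1 t.2
    change J (L (χ t)) ∈ χ.target
    rw [← hy, hLJ, hy]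
    exact χ.map_source ht
  map_target' y hy := by
    rw [dif_pos (mem_preimage.1 hy)]
    exact χ.map_target hy
  left_inv' t ht := by
    obtain ⟨y, hy⟩ := (hχ t ht).1 t.2
    have h : J (L (χ t)) = χ t := by rw [← hy, hLJ]
    have h' : J (L (χ t)) ∈ χ.target := by rw [h]; exact χ.map_source ht
    rw [dif_pos h']
    exact Subtype.ext ((congrArg χ.symm h).trans (χ.left_inv ht))
  right_inv' y hy := by
    rw [dif_pos (mem_preimage.1 hy)]
    change L (χ (χ.symm (J y))) = y
    rw [χ.right_inv hy, hLJ]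
  open_source := χ.open_source.preimage continuous_subtype_val
  open_target := χ.open_target.preimage J.continuous
  continuousOn_toFun := L.continuous.comp_continuousOn
    (χ.continuousOn.comp continuous_subtype_val.continuousOn fun _ ht => ht)
  continuousOn_invFun := by
    rw [Topology.IsInducing.subtypeVal.continuousOn_iff]
    refine (χ.continuousOn_symm.comp J.continuous.continuousOn fun _ hy => hy).congr ?_
    intro y hy
    exact congrArg Subtype.val (dif_pos (mem_preimage.1 hy))

variable {T : Set N} {J : G →L[ℝ] E} {L : E →L[ℝ] G} {hLJ : ∀ y, L (J y) = y}
  {χ : OpenPartialHomeomorph N E} {hχ : ∀ x ∈ χ.source, x ∈ T ↔ χ x ∈ range J} {x₀ : T}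

theorem sliceChart_symm_val {y : G} (hy : J y ∈ χ.target) :
    ((sliceChart J L hLJ χ hχ x₀).symm y : N) = χ.symm (J y) := by
  exact congrArg Subtype.val (dif_pos hy)

/-- A subset of a manifold that is given by a fixed subspace in suitable charts is an embedded
submanifold. -/
theorem exists_submanifold_of_slice_charts [FiniteDimensional ℝ E] [ChartedSpace E N]
    [IsManifold 𝓘(ℝ, E) ∞ N] (K : Submodule ℝ E) (T : Set N)
    (h : ∀ x ∈ T, ∃ χ ∈ IsManifold.maximalAtlas 𝓘(ℝ, E) ∞ N,
      x ∈ χ.source ∧ ∀ y ∈ χ.source, y ∈ T ↔ χ y ∈ K) :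
    ∃ (n : ℕ) (_ : ChartedSpace (EuclideanSpace ℝ (Fin n)) T), IsManifold (𝓡 n) ∞ T ∧
      Manifold.IsSmoothEmbedding (𝓡 n) 𝓘(ℝ, E) ∞ (Subtype.val : T → N) := by
  obtain ⟨K', hK'⟩ := K.exists_isCompl
  let n := Module.finrank ℝ K
  let κ : EuclideanSpace ℝ (Fin n) ≃L[ℝ] K :=
    ContinuousLinearEquiv.ofFinrankEq (by simp [n])
  -- Identifying `K` with a Euclidean space and choosing a complement `K'` presents the model as a
  -- product. `J` is the inclusion of the first factor and `L` the projection to it; `Φ` also gives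
  -- the normal form of an immersion.
  let Φ : (EuclideanSpace ℝ (Fin n) × K') ≃L[ℝ] E :=
    (κ.prodCongr (ContinuousLinearEquiv.refl ℝ K')).trans
      (K.prodEquivOfIsCompl K' hK').toContinuousLinearEquiv
  let J : EuclideanSpace ℝ (Fin n) →L[ℝ] E :=
    Φ.toContinuousLinearMap ∘L ContinuousLinearMap.inl ℝ _ K'
  let L : E →L[ℝ] EuclideanSpace ℝ (Fin n) :=
    ContinuousLinearMap.fst ℝ _ K' ∘L Φ.symm.toContinuousLinearMap
  have hLJ : ∀ y, L (J y) = y := fun y => by simp [L, J]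
  have hJ : ∀ y, J y = κ y := fun y => by simp [J, Φ]
  have hrange : ∀ z, z ∈ range J ↔ z ∈ K := by
    intro z
    constructor
    · rintro ⟨y, rfl⟩
      rw [hJ]
      exact (κ y).2
    · intro hz
      exact ⟨κ.symm ⟨z, hz⟩, by rw [hJ]; simp⟩
  choose χ hχ hmem hslice using fun t : T => h t t.2
  let c : T → OpenPartialHomeomorph T (EuclideanSpace ℝ (Fin n)) := fun t =>
    sliceChart J L hLJ (χ t) (fun y hy => (hslice t y hy).trans (hrange _).symm) t
  let cs : ChartedSpace (EuclideanSpace ℝ (Fin n)) T :=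
    { atlas := range c
      chartAt := c
      mem_chart_source := fun t => hmem t
      chart_mem_atlas := fun t => mem_range_self t }
  have hman : IsManifold (𝓡 n) ∞ T := by
    apply isManifold_of_contDiffOn
    rintro _ _ ⟨s, rfl⟩ ⟨t, rfl⟩
    -- A transition between slice charts is an ambient transition, preceded by `J` and followed by
    -- `L`, hence smooth.
    have key : ContDiffOn ℝ ∞ ((c s).symm ≫ₕ c t) ((c s).symm ≫ₕ c t).source := by
      have hm : MapsTo J ((c s).symm ≫ₕ c t).source ((χ s).symm ≫ₕ χ t).source := by
        intro y hy
        have hy' : J y ∈ (χ s).target ∧ ((c s).symm y : N) ∈ (χ t).source := hy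
        rw [sliceChart_symm_val hy'.1] at hy'
        simpa using hy'
      refine (L.contDiff.comp_contDiffOn ((chart_transition (hχ s) (hχ t)).comp
        J.contDiff.contDiffOn hm)).congr ?_
      intro y hy
      have hy' : J y ∈ (χ s).target := hy.1
      change L (χ t ((c s).symm y : N)) = _
      rw [sliceChart_symm_val hy']
      rfl
    simpa using! key
  refine ⟨n, cs, hman, ⟨⟨K', inferInstance, inferInstance, fun t => ?_⟩, .subtypeVal⟩⟩
  -- In the charts `c t` and `χ t` the inclusion reads `y ↦ Φ (y, 0) = J y`. The same complement
  -- `K'` serves at every point.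
  refine Manifold.IsImmersionAtOfComplement.mk_of_charts Φ (c t) (χ t) (hmem t) (hmem t)
    (IsManifold.chart_mem_maximalAtlas t) (hχ t) (fun _ hs => hs) ?_
  intro y hy
  have hy' : J y ∈ (χ t).target := by simpa using! hy
  change χ t ((c t).symm y : N) = J y
  rw [sliceChart_symm_val hy', (χ t).right_inv hy']

end Slice

/-! ### The local equations as a symmetry condition, and their invariance -/

namespace JetBundle

variable {m : ℕ}

/-- The jet coordinates with the lower indices `e^ν_{kσ} e^σ_l` symmetric in `k` and `l`. -/
def symmetricCoords (m : ℕ) : Submodule ℝ (JetModel m) where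
  carrier := {p | ∀ a b, p.2.2 a b = p.2.2 b a}
  zero_mem' _ _ := rfl
  add_mem' hp hq a b := congrArg₂ (· + ·) (hp a b) (hq a b)
  smul_mem' c _ hp a b := congrArg (c • ·) (hp a b)

/-- The change of coordinates `(x, B, P) ↦ (x, B, P ∘ B)`, which expresses the derivatives of a
frame along the frame itself. -/
def frameDerivatives (m : ℕ) : OpenPartialHomeomorph (JetModel m) (JetModel m) where
  toFun p := (p.1, p.2.1, p.2.2 ∘L p.2.1)
  invFun p := (p.1, p.2.1, p.2.2 ∘L p.2.1.inverse)
  source := {p | p.2.1.IsInvertible}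
  target := {p | p.2.1.IsInvertible}
  map_source' _ hp := hp
  map_target' _ hp := hp
  left_inv' p hp := by
    change p.2.1.IsInvertible at hp
    simp [ContinuousLinearMap.comp_assoc, hp.self_comp_inverse]
  right_inv' p hp := by
    change p.2.1.IsInvertible at hp
    simp [ContinuousLinearMap.comp_assoc, hp.inverse_comp_self]
  open_source := FrameBundle.isOpen_isInvertible.preimage (continuous_snd.fst)
  open_target := FrameBundle.isOpen_isInvertible.preimage (continuous_snd.fst)
  continuousOn_toFun := (by fun_prop : Continuous _).continuousOn
  continuousOn_invFun := by
    have h : ContinuousOn (fun p : JetModel m => p.2.1.inverse) {p | p.2.1.IsInvertible} :=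
      fun p hp => ((hp.contDiffAt_map_inverse (n := 0)).continuousAt.comp
        (f := fun p : JetModel m => p.2.1) continuous_snd.fst.continuousAt).continuousWithinAt
    exact continuousOn_fst.prodMk ((by fun_prop : ContinuousOn (fun p : JetModel m => p.2.1) _).prodMk
      ((by fun_prop : ContinuousOn (fun p : JetModel m => p.2.2) _).clm_comp h))

theorem contDiff_frameDerivatives : ContDiff ℝ ∞ (frameDerivatives m) :=
  contDiff_fst.prodMk (contDiff_snd.fst.prodMk (contDiff_snd.snd.clm_comp contDiff_snd.fst))

theorem contDiffOn_frameDerivatives_symm :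
    ContDiffOn ℝ ∞ (frameDerivatives m).symm (frameDerivatives m).target := by
  have h : ContDiffOn ℝ ∞ (fun p : JetModel m => p.2.1.inverse) {p | p.2.1.IsInvertible} :=
    fun p hp => ((ContinuousLinearMap.IsInvertible.contDiffAt_map_inverse hp).comp p
      contDiff_snd.fst.contDiffAt).contDiffWithinAt
  exact contDiffOn_fst.prodMk (contDiff_snd.fst.contDiffOn.prodMk
    (contDiff_snd.snd.contDiffOn.clm_comp h))

/-- The symmetry of `P ∘ B` in terms of the matrices of `B` and of the `P ∂_σ`. -/
theorem forall_matrix_iff_symmetric {B : V m →L[ℝ] V m} (hB : B.IsInvertible)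
    (P : V m →L[ℝ] V m →L[ℝ] V m) {e : Matrix (Fin m) (Fin m) ℝ}
    (he : ∀ μ k, e μ k = B (EuclideanSpace.single k 1) μ) :
    (∀ μ ν σ : Fin m,
      ∑ i, P (EuclideanSpace.single ν 1) (EuclideanSpace.single i 1) μ * e⁻¹ i σ -
        ∑ i, P (EuclideanSpace.single σ 1) (EuclideanSpace.single i 1) μ * e⁻¹ i ν = 0) ↔
      ∀ a b, P (B a) b = P (B b) a := by
  -- Expansion of `w` in the standard basis: it turns each sum over `i` against a column of the
  -- inverse matrix into the value of a linear map.
  have hsum : ∀ (C : V m →L[ℝ] V m) (w : V m) (μ : Fin m),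
      ∑ i, C (EuclideanSpace.single i 1) μ * w i = C w μ := by
    intro C w μ
    have hw : w = ∑ i, w i • EuclideanSpace.single i (1 : ℝ) := by
      ext j
      simp [Finset.sum_apply, Pi.single_apply]
    conv_rhs => rw [hw, map_sum]
    simp [mul_comm]
  have hinv : e⁻¹ = Matrix.of fun i σ => B.inverse (EuclideanSpace.single σ 1) i := by
    apply Matrix.inv_eq_right_inv
    ext μ σ
    simp only [Matrix.mul_apply, he, Matrix.of_apply]
    rw [hsum, hB.self_apply_inverse]
    simp [Matrix.one_apply]
  simp only [hinv, Matrix.of_apply, hsum, sub_eq_zero]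
  constructor
  · intro h a b
    -- `F u v = P u (B⁻¹ v)`. The equations are the symmetry of this bilinear map on pairs of basis
    -- vectors, hence on all pairs; the choice `u = B a`, `v = B b` removes the inverses.
    let F : V m →L[ℝ] V m →L[ℝ] V m :=
      (ContinuousLinearMap.compL ℝ (V m) (V m) (V m)).flip B.inverse ∘L P
    have hF : F = F.flip := by
      apply ContinuousLinearMap.coe_injective
      apply (EuclideanSpace.basisFun (Fin m) ℝ).toBasis.ext
      intro ν
      apply ContinuousLinearMap.coe_injective
      apply (EuclideanSpace.basisFun (Fin m) ℝ).toBasis.ext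
      intro σ
      ext μ
      simpa [F] using h μ ν σ
    have h' : P (B a) (B.inverse (B b)) = P (B b) (B.inverse (B a)) :=
      DFunLike.congr_fun (DFunLike.congr_fun hF (B a)) (B b)
    rwa [hB.inverse_apply_self, hB.inverse_apply_self] at h'
  · intro h μ ν σ
    have := h (B.inverse (EuclideanSpace.single ν 1)) (B.inverse (EuclideanSpace.single σ 1))
    rw [hB.self_apply_inverse, hB.self_apply_inverse] at this
    rw [this]

variable {M : Type*} [TopologicalSpace M] [ChartedSpace (V m) M] [IsManifold (𝓡 m) ∞ M]
  {φ ψ : OpenPartialHomeomorph M (V m)}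

theorem localEquations_iff (hφ : φ ∈ IsManifold.maximalAtlas (𝓡 m) ∞ M) {ρ : JetBundle m M}
    (hρ : ρ.pt.base ∈ φ.source) : LocalEquations φ ρ ↔
      ∀ a b, (coord φ ρ).2.2 ((coord φ ρ).2.1 a) b = (coord φ ρ).2.2 ((coord φ ρ).2.1 b) a :=
  forall_matrix_iff_symmetric ((chart φ hφ).map_source (x := ρ) hρ).2 (coord φ ρ).2.2 fun _ _ => rfl

/-- The transition maps of `LM` are the maps `(x, B) ↦ (f x, Df_x ∘ B)` for `f` a transition map of
`M`. The second derivative of `f` enters through the dependence of `Df_x` on `x`. -/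
theorem hasFDerivAt_prolongation {E : Type*} [NormedAddCommGroup E] [NormedSpace ℝ E] {f : E → E}
    {x : E} {f' : E →L[ℝ] E} {f'' : E →L[ℝ] E →L[ℝ] E} (hf : HasFDerivAt f f' x)
    (hf' : HasFDerivAt (fderiv ℝ f) f'' x) (B : E →L[ℝ] E) :
    HasFDerivAt (fun q : E × (E →L[ℝ] E) => (f q.1, fderiv ℝ f q.1 ∘L q.2))
      ((f' ∘L ContinuousLinearMap.fst ℝ E (E →L[ℝ] E)).prod
        (ContinuousLinearMap.compL ℝ E E E (fderiv ℝ f x) ∘L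
            ContinuousLinearMap.snd ℝ E (E →L[ℝ] E) +
          (ContinuousLinearMap.compL ℝ E E E).flip B ∘L
            f'' ∘L ContinuousLinearMap.fst ℝ E (E →L[ℝ] E))) (x, B) := by
  have h1 : HasFDerivAt (Prod.fst : E × (E →L[ℝ] E) → E)
      (ContinuousLinearMap.fst ℝ E (E →L[ℝ] E)) (x, B) := hasFDerivAt_fst
  have h2 : HasFDerivAt (Prod.snd : E × (E →L[ℝ] E) → _)
      (ContinuousLinearMap.snd ℝ E (E →L[ℝ] E)) (x, B) := hasFDerivAt_snd
  have h3 := HasFDerivAt.comp (x, B) hf h1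
  have h4 := HasFDerivAt.comp (x, B) hf' h1
  exact h3.prodMk (h4.clm_comp h2)

/-- The third coordinate changes by the derivative of the transition map of `LM`, precomposed with
that of the inverse transition of `M`. Evaluating at the new frame vector `Df (B a)` cancels the
inverse, and the product rule for `Df_x ∘ B` gives the two terms. -/
theorem coord_change (hφ : φ ∈ IsManifold.maximalAtlas (𝓡 m) ∞ M)
    (hψ : ψ ∈ IsManifold.maximalAtlas (𝓡 m) ∞ M) {ρ : JetBundle m M}
    (hρ : ρ.pt.base ∈ φ.source) (hρ' : ρ.pt.base ∈ ψ.source) (a b : V m) :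
    (coord ψ ρ).2.2 ((coord ψ ρ).2.1 a) b =
      fderiv ℝ (fderiv ℝ (ψ ∘ φ.symm)) (φ ρ.pt.base) ((coord φ ρ).2.1 a) ((coord φ ρ).2.1 b) +
        fderiv ℝ (ψ ∘ φ.symm) (φ ρ.pt.base) ((coord φ ρ).2.2 ((coord φ ρ).2.1 a) b) := by
  -- The coordinates are made opaque, so that `ofCoord φ p` can be replaced by `ρ` without unfolding
  -- them.
  obtain ⟨p, hp⟩ : ∃ p, p = coord φ ρ := ⟨_, rfl⟩
  have hinv : ofCoord φ p = ρ := hp ▸ (chart φ hφ).left_inv (x := ρ) hρ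
  have hx : φ ρ.pt.base = p.1 := by rw [hp]; rfl
  have hB : p.2.1.IsInvertible := hp ▸ ((chart φ hφ).map_source (x := ρ) hρ).2
  have hsrc : p.1 ∈ (φ.symm ≫ₕ ψ).source := by
    rw [← hx]
    simp [hρ, hρ']
  have hdom : (p.1, p.2.1) ∈ (φ.symm ≫ₕ ψ).source ×ˢ {A : V m →L[ℝ] V m | A.IsInvertible} :=
    ⟨hsrc, hB⟩
  have hc := chart_trans_apply hφ hψ (p := p) hdom
  rw [hinv] at hc
  rw [hc, ← hp, hx]
  have hf := chart_transition hφ hψ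
  have hopen := (φ.symm ≫ₕ ψ).open_source
  have hf1 : HasFDerivAt (ψ ∘ φ.symm) (fderiv ℝ (ψ ∘ φ.symm) p.1) p.1 :=
    ((hf.contDiffAt (hopen.mem_nhds hsrc)).differentiableAt (by simp)).hasFDerivAt
  have hf2 : HasFDerivAt (fderiv ℝ (ψ ∘ φ.symm)) (fderiv ℝ (fderiv ℝ (ψ ∘ φ.symm)) p.1) p.1 :=
    (((hf.fderiv_of_isOpen (m := ∞) hopen (by simp)).contDiffAt
      (hopen.mem_nhds hsrc)).differentiableAt (by simp)).hasFDerivAt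
  have hmem : (ψ ∘ φ.symm) p.1 ∈ (ψ.symm ≫ₕ φ).source := by
    have : p.1 ∈ φ.target ∧ φ.symm p.1 ∈ ψ.source := by simpa using hsrc
    simp [this.1, this.2]
  have hg1 : HasFDerivAt (φ ∘ ψ.symm) (fderiv ℝ (φ ∘ ψ.symm) ((ψ ∘ φ.symm) p.1))
      ((ψ ∘ φ.symm) p.1) :=
    (((chart_transition hψ hφ).contDiffAt ((ψ.symm ≫ₕ φ).open_source.mem_nhds hmem)).differentiableAt
      (by simp)).hasFDerivAt
  -- The two transition maps compose to the identity near the point, so their derivatives are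
  -- inverse to each other by the chain rule.
  have hid : fderiv ℝ (φ ∘ ψ.symm) ((ψ ∘ φ.symm) p.1) ∘L fderiv ℝ (ψ ∘ φ.symm) p.1 =
      ContinuousLinearMap.id ℝ (V m) := by
    refine (hg1.comp p.1 hf1).unique ((hasFDerivAt_id p.1).congr_of_eventuallyEq ?_)
    filter_upwards [hopen.mem_nhds hsrc] with y hy
    have : y ∈ φ.target ∧ φ.symm y ∈ ψ.source := by simpa using hy
    simp [this.1, this.2]
  have hF : HasFDerivAt (FrameBundle.coord ψ ∘ FrameBundle.ofCoord φ)
      ((fderiv ℝ (ψ ∘ φ.symm) p.1 ∘L ContinuousLinearMap.fst ℝ _ _).prod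
        (ContinuousLinearMap.compL ℝ (V m) (V m) (V m) (fderiv ℝ (ψ ∘ φ.symm) p.1) ∘L
            ContinuousLinearMap.snd ℝ _ _ +
          (ContinuousLinearMap.compL ℝ (V m) (V m) (V m)).flip p.2.1 ∘L
            fderiv ℝ (fderiv ℝ (ψ ∘ φ.symm)) p.1 ∘L ContinuousLinearMap.fst ℝ _ _))
      (p.1, p.2.1) := by
    have h1 := hasFDerivAt_prolongation hf1 hf2 p.2.1
    refine h1.congr_of_eventuallyEq ?_
    filter_upwards [(hopen.prod FrameBundle.isOpen_isInvertible).mem_nhds hdom] with q hq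
    exact FrameBundle.chart_trans_apply hφ hψ hq
  rw [hF.fderiv]
  have hid' : ∀ w, fderiv ℝ (φ ∘ ψ.symm) ((ψ ∘ φ.symm) p.1) (fderiv ℝ (ψ ∘ φ.symm) p.1 w) = w :=
    DFunLike.congr_fun hid
  change (fderiv ℝ (ψ ∘ φ.symm) p.1 ∘L p.2.2 (fderiv ℝ (φ ∘ ψ.symm) ((ψ ∘ φ.symm) p.1)
      (fderiv ℝ (ψ ∘ φ.symm) p.1 (p.2.1 a))) +
    fderiv ℝ (fderiv ℝ (ψ ∘ φ.symm)) p.1 (fderiv ℝ (φ ∘ ψ.symm) ((ψ ∘ φ.symm) p.1)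
      (fderiv ℝ (ψ ∘ φ.symm) p.1 (p.2.1 a))) ∘L p.2.1) b = _
  rw [hid', add_comm]
  rfl

/-- In `coord_change` the second derivative of the transition map is symmetric, and the other term
is linear in the old expression `P (B a) b`, which is symmetric by hypothesis. -/
theorem LocalEquations.change_chart (hφ : φ ∈ IsManifold.maximalAtlas (𝓡 m) ∞ M)
    (hψ : ψ ∈ IsManifold.maximalAtlas (𝓡 m) ∞ M) {ρ : JetBundle m M}
    (hρ : ρ.pt.base ∈ φ.source) (hρ' : ρ.pt.base ∈ ψ.source) (h : LocalEquations φ ρ) :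
    LocalEquations ψ ρ := by
  rw [localEquations_iff hφ hρ] at h
  rw [localEquations_iff hψ hρ']
  intro a b
  have hx : φ ρ.pt.base ∈ (φ.symm ≫ₕ ψ).source := by simp [hρ, hρ']
  have hsymm : IsSymmSndFDerivAt ℝ (ψ ∘ φ.symm) (φ ρ.pt.base) :=
    ((chart_transition hφ hψ).contDiffAt
      ((φ.symm ≫ₕ ψ).open_source.mem_nhds hx)).isSymmSndFDerivAt (by
        simpa using WithTop.coe_le_coe.2 (le_top (a := (2 : ℕ∞))))
  rw [coord_change hφ hψ hρ hρ', coord_change hφ hψ hρ hρ', h a b, hsymm.eq]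

theorem localEquations_iff_of_charts (hφ : φ ∈ IsManifold.maximalAtlas (𝓡 m) ∞ M)
    (hψ : ψ ∈ IsManifold.maximalAtlas (𝓡 m) ∞ M) {ρ : JetBundle m M}
    (hρ : ρ.pt.base ∈ φ.source) (hρ' : ρ.pt.base ∈ ψ.source) :
    LocalEquations φ ρ ↔ LocalEquations ψ ρ :=
  ⟨.change_chart hφ hψ hρ hρ', .change_chart hψ hφ hρ' hρ⟩

/-- The fibered charts are charts of the manifold `J¹τ`. -/
def openChart (φ : OpenPartialHomeomorph M (V m)) (hφ : φ ∈ IsManifold.maximalAtlas (𝓡 m) ∞ M) :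
    OpenPartialHomeomorph (JetBundle m M) (JetModel m) :=
  (smoothAtlas m M).core.openPartialHomeomorph (chart φ hφ) ⟨φ, hφ, rfl⟩

theorem openChart_mem (hφ : φ ∈ IsManifold.maximalAtlas (𝓡 m) ∞ M) :
    openChart φ hφ ∈ IsManifold.maximalAtlas 𝓘(ℝ, JetModel m) ∞ (JetBundle m M) := by
  apply IsManifold.subset_maximalAtlas
  change _ ∈ ⋃ (e : PartialEquiv (JetBundle m M) (JetModel m))
    (he : e ∈ (smoothAtlas m M).core.atlas), {(smoothAtlas m M).core.openPartialHomeomorph e he}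
  simp only [mem_iUnion, mem_singleton_iff]
  exact ⟨chart φ hφ, ⟨φ, hφ, rfl⟩, rfl⟩

/-- These are the slice charts: in them the local equations become linear. -/
theorem openChart_trans_frameDerivatives_mem (hφ : φ ∈ IsManifold.maximalAtlas (𝓡 m) ∞ M) :
    openChart φ hφ ≫ₕ frameDerivatives m ∈
      IsManifold.maximalAtlas 𝓘(ℝ, JetModel m) ∞ (JetBundle m M) := by
  apply OpenPartialHomeomorph.mem_maximalAtlas_of_contMDiffOn
  · exact contDiff_frameDerivatives.contMDiff.comp_contMDiffOn
      ((contMDiffOn_of_mem_maximalAtlas (openChart_mem hφ)).mono fun _ h => h.1)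
  · exact (contMDiffOn_symm_of_mem_maximalAtlas (openChart_mem hφ)).comp
      (contDiffOn_frameDerivatives_symm.contMDiffOn.mono fun _ h => h.1) fun _ h => h.2

variable (m M) in
/-- The jets that satisfy the local equations. -/
def torsionFree : Set (JetBundle m M) := {ρ | LocalEquations (chartAt (V m) ρ.pt.base) ρ}

theorem mem_torsionFree_iff (hφ : φ ∈ IsManifold.maximalAtlas (𝓡 m) ∞ M) {ρ : JetBundle m M}
    (hρ : ρ.pt.base ∈ φ.source) : ρ ∈ torsionFree m M ↔ LocalEquations φ ρ :=
  localEquations_iff_of_charts (IsManifold.chart_mem_maximalAtlas _) hφ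
    (mem_chart_source (V m) _) hρ

theorem exists_slice_chart (ρ : JetBundle m M) :
    ∃ χ ∈ IsManifold.maximalAtlas 𝓘(ℝ, JetModel m) ∞ (JetBundle m M),
      ρ ∈ χ.source ∧ ∀ ρ' ∈ χ.source, ρ' ∈ torsionFree m M ↔ χ ρ' ∈ symmetricCoords m := by
  have hφ : chartAt (V m) ρ.pt.base ∈ IsManifold.maximalAtlas (𝓡 m) ∞ M :=
    IsManifold.chart_mem_maximalAtlas _
  have hρ : ρ ∈ (openChart _ hφ).source := mem_chart_source (V m) ρ.pt.base
  refine ⟨_, openChart_trans_frameDerivatives_mem hφ,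
    ⟨hρ, ((openChart _ hφ).map_source hρ).2⟩, fun ρ' h => ?_⟩
  rw [mem_torsionFree_iff hφ h.1, localEquations_iff hφ h.1]
  rfl

end JetBundle

/-! ### The canonical form and its exterior derivative in the model space -/

section Coordinates

variable {E F G : Type*} [NormedAddCommGroup E] [NormedSpace ℝ E] [NormedAddCommGroup F]
  [NormedSpace ℝ F] [NormedAddCommGroup G] [NormedSpace ℝ G]

theorem wedgeAct_apply_of_one (w : F →L[ℝ] E →L[ℝ] E) (α : F [⋀^Fin 1]→L[ℝ] E) (v : Fin 2 → F) :
    wedgeAct w α v = w (v 0) (α fun _ => v 1) - w (v 1) (α fun _ => v 0) := by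
  refine (ContinuousAlternatingMap.alternatizeUncurryFin_apply _ v).trans ?_
  have h0 : Fin.removeNth 0 v = fun _ : Fin 1 => v 1 := by
    ext i; fin_cases i; rfl
  have h1 : Fin.removeNth 1 v = fun _ : Fin 1 => v 0 := by
    ext i; fin_cases i; rfl
  simp [Fin.sum_univ_two, h0, h1, sub_eq_add_neg]

theorem mfderiv_dropLast (p Y : E × F × G) :
    (mfderiv 𝓘(ℝ, E × F × G) 𝓘(ℝ, E × F) (fun q : E × F × G => (q.1, q.2.1)) p :
      E × F × G →L[ℝ] E × F) Y = (Y.1, Y.2.1) := by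
  rw [mfderiv_eq_fderiv]
  exact DFunLike.congr_fun (((ContinuousLinearMap.fst ℝ E (F × G)).prod
    (ContinuousLinearMap.fst ℝ F G ∘L ContinuousLinearMap.snd ℝ E (F × G))).fderiv (x := p)) Y

theorem DiffForm.wedgeAct_apply_of_one {N : Type*} [TopologicalSpace N] [ChartedSpace F N]
    (w : ∀ x : N, TangentSpace 𝓘(ℝ, F) x →L[ℝ] E →L[ℝ] E) (α : DiffForm F N E 1) (x : N)
    (v : Fin 2 → F) :
    (DiffForm.wedgeAct w α x : F [⋀^Fin 2]→L[ℝ] E) v =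
      w x (v 0) ((α x : F [⋀^Fin 1]→L[ℝ] E) fun _ => v 1) -
        w x (v 1) ((α x : F [⋀^Fin 1]→L[ℝ] E) fun _ => v 0) :=
  FrameJet.wedgeAct_apply_of_one (F := F) (w x) (α x) v

/-- In coordinates `(x, B)` of the frame bundle, the canonical form is `B⁻¹ dx`. -/
def localCanonicalForm (p : E × (E →L[ℝ] E) × G) : (E × (E →L[ℝ] E) × G) [⋀^Fin 1]→L[ℝ] E :=
  ContinuousAlternatingMap.ofSubsingleton ℝ (E × (E →L[ℝ] E) × G) E (0 : Fin 1)
    (p.2.1.inverse ∘L ContinuousLinearMap.fst ℝ E ((E →L[ℝ] E) × G))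

variable [CompleteSpace E]

/-- The formula `d(B⁻¹) = -B⁻¹ dB B⁻¹`, obtained by differentiating the relation `C (C⁻¹ w) = w`,
which holds for all `C` near `B`. -/
theorem hasFDerivAt_inverse_apply {B : E →L[ℝ] E} (hB : B.IsInvertible) (w : E) :
    HasFDerivAt (fun C : E →L[ℝ] E => C.inverse w)
      (-(B.inverse ∘L ContinuousLinearMap.apply ℝ E (B.inverse w))) B := by
  have h1 : HasFDerivAt (ContinuousLinearMap.inverse : (E →L[ℝ] E) → (E →L[ℝ] E))
      (fderiv ℝ (ContinuousLinearMap.inverse : (E →L[ℝ] E) → (E →L[ℝ] E)) B) B :=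
    ((hB.contDiffAt_map_inverse (n := 1)).differentiableAt (by simp)).hasFDerivAt
  have h2 : HasFDerivAt (fun C : E →L[ℝ] E => C.inverse w) (ContinuousLinearMap.apply ℝ E w ∘L
      fderiv ℝ (ContinuousLinearMap.inverse : (E →L[ℝ] E) → (E →L[ℝ] E)) B) B :=
    (ContinuousLinearMap.apply ℝ E w).hasFDerivAt.comp B h1
  have hid : HasFDerivAt (fun C : E →L[ℝ] E => C) (ContinuousLinearMap.id ℝ (E →L[ℝ] E)) B :=
    hasFDerivAt_id B
  have h3 := hid.clm_apply h2
  have h4 : HasFDerivAt (fun C : E →L[ℝ] E => C (C.inverse w))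
      (0 : (E →L[ℝ] E) →L[ℝ] E) B := by
    refine (hasFDerivAt_const (𝕜 := ℝ) w B).congr_of_eventuallyEq ?_
    have hopen : IsOpen {C : E →L[ℝ] E | C.IsInvertible} := ContinuousLinearEquiv.isOpen
    filter_upwards [hopen.mem_nhds hB] with C hC
    exact ContinuousLinearMap.IsInvertible.self_apply_inverse hC w
  have h5 := h3.unique h4
  refine h2.congr_fderiv ?_
  ext1 A
  have h6 := DFunLike.congr_fun h5 A
  apply hB.injective
  simp at h6 ⊢
  rw [hB.self_apply_inverse]
  exact eq_neg_of_add_eq_zero_left h6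

/-- Only the coefficient `B⁻¹` varies, so `dθ = d(B⁻¹) ∧ dx = -B⁻¹ dB ∧ B⁻¹ dx`. -/
theorem extDeriv_localCanonicalForm {p : E × (E →L[ℝ] E) × G} (hp : p.2.1.IsInvertible)
    (v : Fin 2 → E × (E →L[ℝ] E) × G) :
    extDeriv localCanonicalForm p v =
      p.2.1.inverse ((v 1).2.1 (p.2.1.inverse (v 0).1)) -
        p.2.1.inverse ((v 0).2.1 (p.2.1.inverse (v 1).1)) := by
  have hd : DifferentiableAt ℝ (localCanonicalForm (E := E) (G := G)) p := by
    have h1 : DifferentiableAt ℝ (fun q : E × (E →L[ℝ] E) × G => q.2.1.inverse) p :=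
      ((hp.contDiffAt_map_inverse (n := 1)).differentiableAt (by simp)).comp p
        (f := fun q : E × (E →L[ℝ] E) × G => q.2.1) (by fun_prop)
    exact (ContinuousAlternatingMap.ofSubsingletonLIE (𝕜 := ℝ) (E := E × (E →L[ℝ] E) × G) (F := E)
      (0 : Fin 1)).toContinuousLinearEquiv.differentiableAt.comp p
      (h1.clm_comp (differentiableAt_const _))
  rw [extDeriv_apply hd]
  have hf : ∀ (w : E × (E →L[ℝ] E) × G) (u : Fin 1 → E × (E →L[ℝ] E) × G),
      fderiv ℝ (fun q => localCanonicalForm q u) p w =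
        -p.2.1.inverse (w.2.1 (p.2.1.inverse (u 0).1)) := by
    intro w u
    have h1 : HasFDerivAt (fun q : E × (E →L[ℝ] E) × G => q.2.1)
        (ContinuousLinearMap.fst ℝ (E →L[ℝ] E) G ∘L
          ContinuousLinearMap.snd ℝ E ((E →L[ℝ] E) × G)) p :=
      (ContinuousLinearMap.fst ℝ (E →L[ℝ] E) G ∘L
          ContinuousLinearMap.snd ℝ E ((E →L[ℝ] E) × G)).hasFDerivAt
    have h2 := HasFDerivAt.comp p (hasFDerivAt_inverse_apply hp (u 0).1) h1
    exact DFunLike.congr_fun h2.fderiv w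
  simp only [hf]
  simp [Fin.removeNth]
  abel

end Coordinates

/-! ### The torsion in coordinates -/

namespace JetBundle

variable {m : ℕ} {M : Type*} [TopologicalSpace M] [ChartedSpace (V m) M] [IsManifold (𝓡 m) ∞ M]
  {φ : OpenPartialHomeomorph M (V m)}

theorem contMDiff_pt : ContMDiff 𝓘(ℝ, JetModel m) 𝓘(ℝ, FrameModel m) ∞
    (pt : JetBundle m M → FrameBundle m M) := by
  intro ρ
  have hφ : chartAt (V m) ρ.pt.base ∈ IsManifold.maximalAtlas (𝓡 m) ∞ M :=
    IsManifold.chart_mem_maximalAtlas _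
  have hρ : ρ ∈ (openChart _ hφ).source := mem_chart_source (V m) ρ.pt.base
  have h1 := contMDiffOn_of_mem_maximalAtlas (openChart_mem hφ)
  have h2 := contMDiffOn_symm_of_mem_maximalAtlas (FrameBundle.openChart_mem hφ)
  have hc : ContDiff ℝ ∞ (fun p : JetModel m => ((p.1, p.2.1) : FrameModel m)) := by fun_prop
  have h3 : ContMDiffOn 𝓘(ℝ, JetModel m) 𝓘(ℝ, FrameModel m) ∞
      ((FrameBundle.openChart _ hφ).symm ∘ (fun p : JetModel m => ((p.1, p.2.1) : FrameModel m)) ∘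
        openChart _ hφ) (openChart _ hφ).source :=
    h2.comp (hc.contMDiff.comp_contMDiffOn h1) fun σ hσ => (openChart _ hφ).map_source hσ
  refine (h3.congr fun σ hσ => ?_).contMDiffAt ((openChart _ hφ).open_source.mem_nhds hρ)
  exact ((FrameBundle.openChart _ hφ).left_inv hσ).symm

/-- Differential of a fibered chart of `J¹τ`. -/
def D (φ : OpenPartialHomeomorph M (V m)) (ρ : JetBundle m M) : JetModel m →L[ℝ] JetModel m :=
  mfderiv 𝓘(ℝ, JetModel m) 𝓘(ℝ, JetModel m) (coord φ) ρ

/-- Differential of the projection `J¹τ → LM`. -/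
def DPt (ρ : JetBundle m M) : JetModel m →L[ℝ] FrameModel m :=
  mfderiv 𝓘(ℝ, JetModel m) 𝓘(ℝ, FrameModel m) (pt : JetBundle m M → FrameBundle m M) ρ

theorem D_DPt (hφ : φ ∈ IsManifold.maximalAtlas (𝓡 m) ∞ M) {ρ : JetBundle m M}
    (hρ : ρ.pt.base ∈ φ.source) (Y : JetModel m) :
    FrameBundle.D φ ρ.pt (DPt ρ Y) = ((D φ ρ Y).1, (D φ ρ Y).2.1) := by
  have h1 : MDifferentiableAt 𝓘(ℝ, JetModel m) 𝓘(ℝ, JetModel m) (coord φ) ρ :=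
    (chart_mdifferentiable (openChart_mem hφ)).mdifferentiableAt hρ
  have h2 : MDifferentiableAt 𝓘(ℝ, JetModel m) 𝓘(ℝ, FrameModel m)
      (pt : JetBundle m M → FrameBundle m M) ρ := (contMDiff_pt ρ).mdifferentiableAt (by simp)
  have h3 : MDifferentiableAt 𝓘(ℝ, FrameModel m) 𝓘(ℝ, FrameModel m) (FrameBundle.coord φ) ρ.pt :=
    (chart_mdifferentiable (FrameBundle.openChart_mem hφ)).mdifferentiableAt hρ
  have hc : ContDiff ℝ ∞ (fun p : JetModel m => ((p.1, p.2.1) : FrameModel m)) := by fun_prop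
  have e1 := mfderiv_comp ρ (I' := 𝓘(ℝ, JetModel m)) (I'' := 𝓘(ℝ, FrameModel m))
    (hc.contMDiff.mdifferentiableAt (by simp)) h1
  have e2 := mfderiv_comp ρ h3 h2
  refine (DFunLike.congr_fun e2.symm Y).trans ((DFunLike.congr_fun e1 Y).trans ?_)
  exact mfderiv_dropLast (coord φ ρ) (D φ ρ Y)

/-- The third coordinate of a jet is defined on coordinate vectors through the differential of
`φ.symm`, which undoes that of `φ`. -/
theorem D_lift (hφ : φ ∈ IsManifold.maximalAtlas (𝓡 m) ∞ M) {ρ : JetBundle m M}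
    (hρ : ρ.pt.base ∈ φ.source) (w : V m) :
    (FrameBundle.D φ ρ.pt (ρ.lift w)).2 =
      (coord φ ρ).2.2 ((mfderiv (𝓡 m) (𝓡 m) φ ρ.pt.base : V m →L[ℝ] V m) w) :=
  congrArg (fun z => (FrameBundle.D φ ρ.pt (ρ.lift z)).2) (FrameBundle.D_symm_D hφ hρ w).symm

/-- In the preferred chart, the connection form is `B⁻¹ (dB - P dx)`. -/
theorem comp_connectionForm (ρ : JetBundle m M) (Y : JetModel m) :
    (coord (chartAt (V m) ρ.pt.base) ρ).2.1 ∘L (connectionForm ρ Y : V m →L[ℝ] V m) =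
      (D (chartAt (V m) ρ.pt.base) ρ Y).2.1 -
        (coord (chartAt (V m) ρ.pt.base) ρ).2.2 (D (chartAt (V m) ρ.pt.base) ρ Y).1 := by
  set φ := chartAt (V m) ρ.pt.base with hφdef
  have hφ : φ ∈ IsManifold.maximalAtlas (𝓡 m) ∞ M := IsManifold.chart_mem_maximalAtlas _
  have hρ : ρ.pt.base ∈ φ.source := mem_chart_source (V m) ρ.pt.base
  obtain ⟨l, hl⟩ : ∃ l : V m →L[ℝ] FrameModel m, l = ρ.lift := ⟨_, rfl⟩
  -- This is the definition of `ω`: its value generates the vertical part of the projection of `Y`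
  -- to `LM`. Applying the differential of the chart turns the generator into `B ∘ ω(Y)` and the two
  -- terms on the right into `dB` and `P dx`.
  have h1 : (ρ.pt.generator (connectionForm ρ Y) : FrameModel m) =
      DPt ρ Y - l (FrameBundle.DBase ρ.pt (DPt ρ Y)) := by
    rw [hl]
    exact congrArg Subtype.val (ρ.pt.verticalEquiv.apply_symm_apply (ρ.verticalProj (DPt ρ Y)))
  have h2 := congrArg Prod.snd (FrameBundle.D_generator ρ.pt (connectionForm ρ Y))
  have h3 := FrameBundle.D_fst hφ hρ (DPt ρ Y)
  have h4 : (FrameBundle.D φ ρ.pt (l (FrameBundle.DBase ρ.pt (DPt ρ Y)))).2 =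
      (coord φ ρ).2.2 (D φ ρ Y).1 := by
    rw [D_DPt hφ hρ] at h3
    rw [hl]
    exact (D_lift hφ hρ _).trans (congrArg (coord φ ρ).2.2 h3.symm)
  have h5 := congrArg Prod.snd (D_DPt hφ hρ Y)
  refine h2.symm.trans ((congrArg (fun Z => (FrameBundle.D φ ρ.pt Z).2) h1).trans ?_)
  exact (congrArg Prod.snd ((FrameBundle.D φ ρ.pt).map_sub _ _)).trans
    (congrArg₂ (· - ·) h5 h4)

/-- `B` is the frame `u` followed by the differential of `φ`, and `dx` is the projection to `TM`
followed by the same differential, which therefore drops out of `B⁻¹ dx`. -/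
theorem canonicalForm_apply (hφ : φ ∈ IsManifold.maximalAtlas (𝓡 m) ∞ M) {ρ : JetBundle m M}
    (hρ : ρ.pt.base ∈ φ.source) (v : Fin 1 → JetModel m) :
    (canonicalForm ρ : JetModel m [⋀^Fin 1]→L[ℝ] V m) v =
      (coord φ ρ).2.1.inverse (D φ ρ (v 0)).1 := by
  have hB : (coord φ ρ).2.1.IsInvertible := ((chart φ hφ).map_source (x := ρ) hρ).2
  change ρ.pt.frame.symm (FrameBundle.DBase ρ.pt (DPt ρ (v 0))) = _
  have h3 := FrameBundle.D_fst hφ hρ (DPt ρ (v 0))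
  rw [D_DPt hφ hρ] at h3
  change (D φ ρ (v 0)).1 = _ at h3
  apply hB.injective
  rw [hB.self_apply_inverse, h3]
  exact congrArg (mfderiv (𝓡 m) (𝓡 m) φ ρ.pt.base : V m →L[ℝ] V m)
    (ρ.pt.frame.apply_symm_apply _)

theorem pullback_canonicalForm (hφ : φ ∈ IsManifold.maximalAtlas (𝓡 m) ∞ M) {p : JetModel m}
    (hp : p ∈ (openChart φ hφ).target) :
    DiffForm.pullback (F := JetModel m) (openChart φ hφ).symm
      (canonicalForm : DiffForm (JetModel m) (JetBundle m M) (V m) 1) p = localCanonicalForm p := by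
  have hρ : (ofCoord (M := M) φ p).pt.base ∈ φ.source := (openChart φ hφ).map_target hp
  have hc : coord φ (ofCoord (M := M) φ p) = p := (openChart φ hφ).right_inv hp
  refine ContinuousAlternatingMap.ext fun v => ?_
  refine (canonicalForm_apply hφ hρ fun i =>
    (mfderiv 𝓘(ℝ, JetModel m) 𝓘(ℝ, JetModel m) (openChart φ hφ).symm p :
      JetModel m →L[ℝ] JetModel m) (v i)).trans ?_
  have h : D φ (ofCoord (M := M) φ p)
      ((mfderiv 𝓘(ℝ, JetModel m) 𝓘(ℝ, JetModel m) (openChart φ hφ).symm p :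
        JetModel m →L[ℝ] JetModel m) (v 0)) = v 0 :=
    DFunLike.congr_fun ((chart_mdifferentiable (openChart_mem hφ)).comp_symm_deriv hp) (v 0)
  rw [hc]
  exact congrArg (fun y : JetModel m => p.2.1.inverse y.1) h

theorem d_canonicalForm_apply (ρ : JetBundle m M) (v : Fin 2 → JetModel m) :
    (canonicalForm.d ρ : JetModel m [⋀^Fin 2]→L[ℝ] V m) v =
      extDeriv (𝕜 := ℝ) (localCanonicalForm (E := V m)) (coord (chartAt (V m) ρ.pt.base) ρ)
        (fun i => D (chartAt (V m) ρ.pt.base) ρ (v i)) := by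
  have hφ : chartAt (V m) ρ.pt.base ∈ IsManifold.maximalAtlas (𝓡 m) ∞ M :=
    IsManifold.chart_mem_maximalAtlas _
  have hρ : ρ ∈ (openChart _ hφ).source := mem_chart_source (V m) ρ.pt.base
  -- The exterior derivative depends only on the germ of the form, so agreement on the target of the
  -- chart is enough.
  have he : DiffForm.pullback (F := JetModel m) (openChart _ hφ).symm
      (canonicalForm : DiffForm (JetModel m) (JetBundle m M) (V m) 1)
        =ᶠ[nhds (coord (chartAt (V m) ρ.pt.base) ρ)] localCanonicalForm := by
    filter_upwards [(openChart _ hφ).open_target.mem_nhds ((openChart _ hφ).map_source hρ)]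
      with p hp
    exact pullback_canonicalForm hφ hp
  exact congrArg (fun α : JetModel m [⋀^Fin 2]→L[ℝ] V m =>
    α fun i => D (chartAt (V m) ρ.pt.base) ρ (v i)) he.extDeriv_eq

theorem connectionForm_apply (ρ : JetBundle m M) (X : JetModel m) (z : V m) :
    (connectionForm ρ X : V m →L[ℝ] V m) z =
      (coord (chartAt (V m) ρ.pt.base) ρ).2.1.inverse
        ((D (chartAt (V m) ρ.pt.base) ρ X).2.1 z -
          (coord (chartAt (V m) ρ.pt.base) ρ).2.2 (D (chartAt (V m) ρ.pt.base) ρ X).1 z) := by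
  have hB : (coord (chartAt (V m) ρ.pt.base) ρ).2.1.IsInvertible :=
    ((chart _ (IsManifold.chart_mem_maximalAtlas ρ.pt.base)).map_source (x := ρ)
      (mem_chart_source (V m) ρ.pt.base)).2
  apply hB.injective
  rw [hB.self_apply_inverse]
  exact DFunLike.congr_fun (comp_connectionForm ρ X) z

theorem wedgeAct_connectionForm_apply (ρ : JetBundle m M) (v : Fin 2 → JetModel m) :
    (DiffForm.wedgeAct connectionForm canonicalForm ρ : JetModel m [⋀^Fin 2]→L[ℝ] V m) v =
      (connectionForm ρ (v 0) : V m →L[ℝ] V m)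
          ((canonicalForm ρ : JetModel m [⋀^Fin 1]→L[ℝ] V m) fun _ => v 1) -
        (connectionForm ρ (v 1) : V m →L[ℝ] V m)
          ((canonicalForm ρ : JetModel m [⋀^Fin 1]→L[ℝ] V m) fun _ => v 0) :=
  DiffForm.wedgeAct_apply_of_one connectionForm canonicalForm ρ v

/-- In the preferred chart, the torsion is `-B⁻¹ (P(dx) B⁻¹ dx)`, antisymmetrized. -/
theorem torsion_apply (ρ : JetBundle m M) (v : Fin 2 → JetModel m) :
    (torsion ρ : JetModel m [⋀^Fin 2]→L[ℝ] V m) v =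
      (coord (chartAt (V m) ρ.pt.base) ρ).2.1.inverse
        ((coord (chartAt (V m) ρ.pt.base) ρ).2.2 (D (chartAt (V m) ρ.pt.base) ρ (v 1)).1
          ((coord (chartAt (V m) ρ.pt.base) ρ).2.1.inverse
            (D (chartAt (V m) ρ.pt.base) ρ (v 0)).1) -
        (coord (chartAt (V m) ρ.pt.base) ρ).2.2 (D (chartAt (V m) ρ.pt.base) ρ (v 0)).1
          ((coord (chartAt (V m) ρ.pt.base) ρ).2.1.inverse
            (D (chartAt (V m) ρ.pt.base) ρ (v 1)).1)) := by
  have hφ : chartAt (V m) ρ.pt.base ∈ IsManifold.maximalAtlas (𝓡 m) ∞ M :=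
    IsManifold.chart_mem_maximalAtlas _
  have hρ : ρ.pt.base ∈ (chartAt (V m) ρ.pt.base).source := mem_chart_source (V m) ρ.pt.base
  have hB : (coord (chartAt (V m) ρ.pt.base) ρ).2.1.IsInvertible :=
    ((chart _ hφ).map_source (x := ρ) hρ).2
  have hd := (d_canonicalForm_apply ρ v).trans (extDeriv_localCanonicalForm hB _)
  have h0 := canonicalForm_apply hφ hρ fun _ => v 0
  have h1 := canonicalForm_apply hφ hρ fun _ => v 1
  have hw := wedgeAct_connectionForm_apply ρ v
  rw [h0, h1, connectionForm_apply, connectionForm_apply] at hw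
  refine (congrArg₂ (· + ·) hd hw).trans ?_
  simp only [map_sub]
  abel

/-- The torsion vanishes at the jets that satisfy the local equations. -/
theorem torsion_eq_zero {ρ : JetBundle m M} (h : ρ ∈ torsionFree m M) : torsion ρ = 0 := by
  have hφ : chartAt (V m) ρ.pt.base ∈ IsManifold.maximalAtlas (𝓡 m) ∞ M :=
    IsManifold.chart_mem_maximalAtlas _
  have hρ : ρ.pt.base ∈ (chartAt (V m) ρ.pt.base).source := mem_chart_source (V m) ρ.pt.base
  rw [mem_torsionFree_iff hφ hρ, localEquations_iff hφ hρ] at h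
  have hB : (coord (chartAt (V m) ρ.pt.base) ρ).2.1.IsInvertible :=
    ((chart _ hφ).map_source (x := ρ) hρ).2
  refine ContinuousAlternatingMap.ext fun (v : Fin 2 → JetModel m) => ?_
  refine (torsion_apply ρ v).trans ?_
  -- The symmetry of `P ∘ B` is used at `θ(v 0)` and `θ(v 1)`, the vectors that `B` sends to `dx(v
  -- 0)` and `dx(v 1)`.
  have hs := h
    ((coord (chartAt (V m) ρ.pt.base) ρ).2.1.inverse (D (chartAt (V m) ρ.pt.base) ρ (v 0)).1)
    ((coord (chartAt (V m) ρ.pt.base) ρ).2.1.inverse (D (chartAt (V m) ρ.pt.base) ρ (v 1)).1)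
  rw [hB.self_apply_inverse, hB.self_apply_inverse] at hs
  rw [hs, sub_self]
  exact map_zero (coord (chartAt (V m) ρ.pt.base) ρ).2.1.inverse

end JetBundle

end FrameJet

end

set_option synthInstance.maxHeartbeats 200000 in
theorem mainTheorem8 (m : ℕ) (M : Type*) [TopologicalSpace M]
    [ChartedSpace (EuclideanSpace ℝ (Fin m)) M] [IsManifold (𝓡 m) ∞ M] :
    -- there is a subset `T₀` of `J¹τ` ...
    ∃ T₀ : Set (FrameJet.JetBundle m M),
      -- ... which is an embedded smooth submanifold on which the torsion pulls back to zero,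
      (∃ (n : ℕ) (_ : ChartedSpace (EuclideanSpace ℝ (Fin n)) T₀),
        IsManifold (𝓡 n) ∞ T₀ ∧
        Manifold.IsSmoothEmbedding (𝓡 n) 𝓘(ℝ, FrameJet.JetModel m) ∞
          (Subtype.val : T₀ → FrameJet.JetBundle m M) ∧
        ∀ t : T₀, FrameJet.DiffForm.pullback (F := EuclideanSpace ℝ (Fin n))
          (Subtype.val : T₀ → FrameJet.JetBundle m M) FrameJet.JetBundle.torsion t = 0) ∧
      -- ... given by the local equations in the fibered coordinates of every chart of `M`,
      (∀ φ ∈ IsManifold.maximalAtlas (𝓡 m) ∞ M, ∀ ρ : FrameJet.JetBundle m M,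
        ρ.pt.base ∈ φ.source → (ρ ∈ T₀ ↔ FrameJet.JetBundle.LocalEquations φ ρ)) ∧
      -- ... and these equations do not depend on the chart.
      (∀ φ ∈ IsManifold.maximalAtlas (𝓡 m) ∞ M, ∀ ψ ∈ IsManifold.maximalAtlas (𝓡 m) ∞ M,
        ∀ ρ : FrameJet.JetBundle m M, ρ.pt.base ∈ φ.source → ρ.pt.base ∈ ψ.source →
          (FrameJet.JetBundle.LocalEquations φ ρ ↔ FrameJet.JetBundle.LocalEquations ψ ρ)) := by
  obtain ⟨n, cs, hman, hemb⟩ := FrameJet.exists_submanifold_of_slice_charts (E := FrameJet.JetModel m)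
    (FrameJet.JetBundle.symmetricCoords m) (FrameJet.JetBundle.torsionFree m M)
    fun ρ _ => FrameJet.JetBundle.exists_slice_chart ρ
  refine ⟨FrameJet.JetBundle.torsionFree m M, ⟨n, cs, hman, hemb, fun t => ?_⟩,
    fun φ hφ ρ hρ => FrameJet.JetBundle.mem_torsionFree_iff hφ hρ,
    fun φ hφ ψ hψ ρ hρ hρ' => FrameJet.JetBundle.localEquations_iff_of_charts hφ hψ hρ hρ'⟩
  -- The pullback evaluates `torsion` at the jet `t` itself, where it is zero on all tangent vectors
  -- of `J¹τ`; nothing about the tangent space of the submanifold is needed.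
  refine ContinuousAlternatingMap.ext fun v => ?_
  exact congrArg (fun α : FrameJet.JetModel m [⋀^Fin 2]→L[ℝ] FrameJet.V m => α _)
    (FrameJet.JetBundle.torsion_eq_zero t.2)
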